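/- Let $M\ge 1$, $N\ge 0$ be integers and let $[n]=\sum_{i=0}^{n-1}q^{n-1-2i}$ be the quantum integer. **Diagrams of type BI.** Let $b\in\{+,-\}^N$ be a binary string. Put at the positions $1,\dots,N$ (from left to right) an up arrow for $+$ and a down arrow for $-$. Repeatedly join adjacent pairs (down, up), in this order, by arcs, ignoring arrows that are already joined, until all remaining up arrows are to the left of all remaining down arrows. Among the remaining down arrows, for $1\le p\le M$ the $(M+1-p)$-th from the right (if it exists) gets the integer $p$; the one with $p=1$ is "the down arrow with a star". The down arrows that are still left are joined in adjacent pairs from right to left by dashed arcs; at most one down arrow stays unpaired. The resulting diagram is $D$. Let $N_\uparrow$ be the number of up arrows not in arcs, $N_1\in\{0,1\}$ the number of unpaired down arrows, $S$ the set of arcs, $T$ the set of dashed arcs, $T'$ the set $T$ without its leftmost element, $U$ (resp. $U'$) the set of down arrows with an integer $p$, $2\le p\le M$ (resp. $2\le p\le M-1$), and $V$ (resp. $V'$) the union of $U$ (resp. $U'$) and the down arrow with a star, if it exists. Let $s_p$ be the position of the down arrow with the integer $p$. The size of an arc or dashed arc $A$ joining the positions $i<j$ is $m_A=(j-i+1)/2$.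 * $S_R$: the arcs to the right of the down arrow with integer $M$ (empty if there is none). * $S_{W'}$: the arcs to the right of the star and to the left of the down arrow with integer $M$ (empty if there is no star). * $S_W$: the arcs to the left of the star and to the right of the unpaired down arrow if $N_1=1$, or of the leftmost down arrow forming a dashed arc if $N_1=0$ (empty if there is no star, or if $N_1=0$ and $T=\emptyset$). * $S_L$: if there is a star, the arcs to the left of all down arrows not in (solid) arcs and to the right of all up arrows not in arcs (empty if there is no star). An arc is outer if it is inside no arc and no dashed arc; $S_R^+$, $S_W^+$, $S_L^+$ are the sets of outer arcs in $S_R$, $S_W$, $S_L$. Put $$N_2=N_\uparrow+N_1+|S|+|T|,\quad N_3=|S_W|+|T|,\quad N_4=|S_{W'}|+|S_W|+|T|+M,$$ $$N_5=N-|S|+|S_L|+|S_W|+|S_{W'}|+|S_R|+M,$$ and $N_6=[N_5]/[N_4]$ if $|V|=M$ and $N_1=0$, $N_6=1$ otherwise. For an arc $A$ joining $i<j$, a down arrow $C$ with integer $p$ and a dashed arc $E$ with left end $k$ put $$d_{1,A,C}=\tfrac{i-s_p+M-p+1}2,\quad d_{2,A}=\tfrac{i-s_1+M}2,\quad d_{3,A}=N-j,\quad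 d_{4,C}=\tfrac{s_M-s_p+M-p}2+1,\quad d_{5,E}=\tfrac{s_M-k+M+1}2.$$ For $A'\in S_W$ let $h_{A'}$ be the number of arcs in $S_W$ to the right of $A'$ or outside of $A'$ (including $A'$), plus the number of dashed arcs to the right of $A'$. Put $$N_7=\prod_{C\in U}\prod_{A\in S_R^+}\frac{[d_{1,A,C}]}{[d_{1,A,C}+m_A]},$$ $$N_8=\prod_{A\in S_R^+}\Bigl(\prod_{i=0}^{N_3}\frac{[d_{2,A}+i]}{[d_{2,A}+m_A+i]}\prod_{A'\in S_W}\frac{[d_{2,A}+m_A+h_{A'}]}{[d_{2,A}+h_{A'}]}\Bigr)\ \text{ if } |V|=M,\qquad N_8=1\ \text{ otherwise},$$ $$N_9=\prod_{A}\frac{[d_{3,A}+m_A+M]}{[d_{3,A}+2m_A+M]},\quad\text{over } A\in S_W^+ \text{ if } N_1=1,\text{ over } A\in S_W^+\cup S_L^+ \text{ if } N_1=0,$$ $$N_{10}=\begin{cases}\prod_{C\in U'}[d_{4,C}]^{-1}, & N_1=0,\ T=\emptyset,\\ \prod_{C\in V'}[d_{4,C}]^{-1}\prod_{E\in T'}[d_{5,E}]^{-1},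 & N_1=0,\ T\ne\emptyset,\\ \prod_{C\in V'}[d_{4,C}]^{-1}\prod_{E\in T}[d_{5,E}]^{-1}, & N_1=1.\end{cases}$$ Number the up arrows not in arcs, the unpaired down arrow, the arcs, the dashed arcs and the elements of $U$ by $1,2,\dots$ from left to right according to their left ends, and let $n_A$ be the number of $A$. Put $N_{11}=\prod_{A\in S\cup T\cup U}[n_A]$, with an additional factor $[n_A]$ for the unpaired down arrow $A$ if $N_1=1$. Number the arcs, the dashed arcs, the elements of $U$ and the down arrow with a star by $1,2,\dots$ from right to left according to their left ends, let $n'_B$ be the number of $B$, and put $$N_{12}=\frac{\prod_{i=1}^{N_2}\bigl(q^{i+M-1}+q^{-(i+M-1)}\bigr)}{\prod_{B\in T\cup(V\setminus U)}\bigl(q^{n'_B}+q^{-n'_B}\bigr)}.$$ Finally define the component $\Psi_D$ of the vector $\Psi$ (with $Q=q^M$) by $$\Psi_D=\prod_{A\in S}[m_A]^{-1}\cdot N_6N_7N_8N_9N_{10}N_{11}N_{12}\in\mathbb{C}(q).$$ **Proposition.** For every $M\ge1$, every $N$ and every binary string $b\in\{+,-\}^N$ with diagram $D$ of type BI, the component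 $\Psi_D$ belongs to $\mathbb{N}[q,q^{-1}]$ and is invariant under $q\mapsto q^{-1}$. Moreover its leading term (highest power of $q$) is $q^{d_D}$ with coefficient one, where $d_D=\sum_j (j+M-1)$, the sum being over the positions $j$ of the letters $+$ of $b$, counted from the right starting with $1$. -/

import Mathlib

namespace TypeBI

/-- The quantum integer `[n] = ∑_{i=0}^{n-1} q^{n-1-2i}`. -/
def qInt {K : Type*} [Field K] (q : K) (n : ℕ) : K :=
  ∑ i ∈ Finset.range n, q ^ ((n : ℤ) - 1 - 2 * (i : ℤ))

/-- The expression `q^n + q^{-n}`. -/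
def qSym {K : Type*} [Field K] (q : K) (n : ℕ) : K :=
  q ^ (n : ℤ) + q ^ (-(n : ℤ))

/-! ### The diagram of a binary string

A binary string of length `N` is `b : Fin N → Bool`, where `true` is `+` (an up arrow) and
`false` is `-` (a down arrow). -/

/-- Arrows are numbered `1, …, N` from left to right. -/
def pos {N : ℕ} (i : Fin N) : ℕ := (i : ℕ) + 1

/-- Number of down arrows minus number of up arrows among the positions `i, …, k`. -/
def excess {N : ℕ} (b : Fin N → Bool) (i k : Fin N) : ℤ :=
  ∑ l ∈ Finset.Icc i k, if b l then -1 else 1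

/-- The (solid) arcs. Repeatedly joining adjacent pairs `↓↑` is the usual matching of parentheses
(`↓` opens and `↑` closes): the down arrow `i` is joined to the first position `j` on its right at
which the ups have compensated the downs counted from `i` on. -/
def arcs {N : ℕ} (b : Fin N → Bool) : Finset (Fin N × Fin N) :=
  Finset.univ.filter fun A =>
    A.1 < A.2 ∧ b A.1 = false ∧ b A.2 = true ∧
      (∀ k, A.1 ≤ k → k < A.2 → 0 < excess b A.1 k) ∧ excess b A.1 A.2 = 0

/-- The up arrows that do not belong to an arc. -/
def ups {N : ℕ} (b : Fin N → Bool) : Finset (Fin N) :=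
  Finset.univ.filter fun i => b i = true ∧ ∀ A ∈ arcs b, A.2 ≠ i

/-- The down arrows that do not belong to a (solid) arc. -/
def downs {N : ℕ} (b : Fin N → Bool) : Finset (Fin N) :=
  Finset.univ.filter fun i => b i = false ∧ ∀ A ∈ arcs b, A.1 ≠ i

/-- The rank, counted from the right and starting with `1`, of `i` among `downs b`. -/
def rank {N : ℕ} (b : Fin N → Bool) (i : Fin N) : ℕ :=
  ((downs b).filter fun k => i ≤ k).card

/-- The integer `p`, `1 ≤ p ≤ M`, carried by the `(M+1-p)`-th element of `downs b` from the right
(`p = 1` is the star). It is `0` for the elements of `downs b` of rank larger than `M`, which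
carry no integer. -/
def label {N : ℕ} (M : ℕ) (b : Fin N → Bool) (i : Fin N) : ℕ := M + 1 - rank b i

/-- The down arrow with the integer `p` (`1 ≤ p ≤ M`), as a set with at most one element. -/
def marked {N : ℕ} (M : ℕ) (b : Fin N → Bool) (p : ℕ) : Finset (Fin N) :=
  (downs b).filter fun i => label M b i = p

/-- The down arrow with a star, as a set with at most one element. -/
def star {N : ℕ} (M : ℕ) (b : Fin N → Bool) : Finset (Fin N) := marked M b 1

/-- The position `s_p` of the down arrow with the integer `p`
(a sum with at most one term; only used when this arrow exists). -/
def markedPos {N : ℕ} (M : ℕ) (b : Fin N → Bool) (p : ℕ) : ℕ := ∑ i ∈ marked M b p, pos i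

/-- The dashed arcs: the elements of `downs b` of rank larger than `M` are joined in pairs from
right to left, that is, the ranks `M+1` and `M+2`, the ranks `M+3` and `M+4`, and so on. -/
def dashed {N : ℕ} (M : ℕ) (b : Fin N → Bool) : Finset (Fin N × Fin N) :=
  (downs b ×ˢ downs b).filter fun E =>
    M < rank b E.2 ∧ Odd (rank b E.2 - M) ∧ rank b E.1 = rank b E.2 + 1

/-- The unpaired down arrow, which carries no integer and belongs to no dashed arc, as a set with
at most one element. -/
def unpaired {N : ℕ} (M : ℕ) (b : Fin N → Bool) : Finset (Fin N) :=
  (downs b).filter fun i => M < rank b i ∧ ∀ E ∈ dashed M b, E.1 ≠ i ∧ E.2 ≠ i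

/-- The size of an arc or of a dashed arc. -/
def size {N : ℕ} (A : Fin N × Fin N) : ℕ := (pos A.2 - pos A.1 + 1) / 2

/-! ### Sets of arcs and arrows -/

/-- The arcs to the right of the down arrow with the integer `M`. -/
def setSR {N : ℕ} (M : ℕ) (b : Fin N → Bool) : Finset (Fin N × Fin N) :=
  (arcs b).filter fun A => ∃ C ∈ marked M b M, C < A.1

/-- The arcs between the star and the down arrow with the integer `M`. -/
def setSW' {N : ℕ} (M : ℕ) (b : Fin N → Bool) : Finset (Fin N × Fin N) :=
  (arcs b).filter fun A => (∃ C ∈ star M b, C < A.1) ∧ ∃ C ∈ marked M b M, A.2 < C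

/-- The arcs to the left of the star and to the right of the unpaired down arrow or, if there is
none, of the leftmost down arrow forming a dashed arc. -/
def setSW {N : ℕ} (M : ℕ) (b : Fin N → Bool) : Finset (Fin N × Fin N) :=
  (arcs b).filter fun A => (∃ C ∈ star M b, A.2 < C) ∧
    ((∃ u ∈ unpaired M b, u < A.1) ∨ (unpaired M b = ∅ ∧ ∃ E ∈ dashed M b, E.1 < A.1))

/-- If there is a star: the arcs to the left of all elements of `downs b` and to the right of all
unpaired up arrows. -/
def setSL {N : ℕ} (M : ℕ) (b : Fin N → Bool) : Finset (Fin N × Fin N) :=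
  (arcs b).filter fun A => (star M b).Nonempty ∧ (∀ C ∈ downs b, A.2 < C) ∧ ∀ u ∈ ups b, u < A.1

/-- The outer arcs: those lying inside no other arc and no dashed arc. -/
def outer {N : ℕ} (M : ℕ) (b : Fin N → Bool) : Finset (Fin N × Fin N) :=
  (arcs b).filter fun A => ∀ B ∈ arcs b ∪ dashed M b, ¬(B.1 < A.1 ∧ A.2 < B.2)

/-- The dashed arcs except the leftmost one. -/
def setT' {N : ℕ} (M : ℕ) (b : Fin N → Bool) : Finset (Fin N × Fin N) :=
  (dashed M b).filter fun E => ∃ F ∈ dashed M b, F.1 < E.1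

/-- The down arrows with an integer `p`, `2 ≤ p ≤ M`. -/
def setU {N : ℕ} (M : ℕ) (b : Fin N → Bool) : Finset (Fin N) :=
  (downs b).filter fun i => 2 ≤ label M b i ∧ label M b i ≤ M

/-- The down arrows with an integer `p`, `2 ≤ p ≤ M - 1`. -/
def setU' {N : ℕ} (M : ℕ) (b : Fin N → Bool) : Finset (Fin N) :=
  (downs b).filter fun i => 2 ≤ label M b i ∧ label M b i ≤ M - 1

def setV {N : ℕ} (M : ℕ) (b : Fin N → Bool) : Finset (Fin N) := setU M b ∪ star M b

def setV' {N : ℕ} (M : ℕ) (b : Fin N → Bool) : Finset (Fin N) := setU' M b ∪ star M b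

/-! ### The integers entering the formula

In the natural number expressions below no subtraction is truncated and all divisions by two are
exact, for the arguments at which they are used. -/

def N1 {N : ℕ} (M : ℕ) (b : Fin N → Bool) : ℕ := (unpaired M b).card

def N2 {N : ℕ} (M : ℕ) (b : Fin N → Bool) : ℕ :=
  (ups b).card + N1 M b + (arcs b).card + (dashed M b).card

def N3 {N : ℕ} (M : ℕ) (b : Fin N → Bool) : ℕ := (setSW M b).card + (dashed M b).card

def N4 {N : ℕ} (M : ℕ) (b : Fin N → Bool) : ℕ :=
  (setSW' M b).card + (setSW M b).card + (dashed M b).card + M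

def N5 {N : ℕ} (M : ℕ) (b : Fin N → Bool) : ℕ :=
  N - (arcs b).card + (setSL M b).card + (setSW M b).card + (setSW' M b).card
    + (setSR M b).card + M

/-- `d_{1,A,C}`, for an arc `A` to the right of a down arrow `C` with an integer. -/
def d1 {N : ℕ} (M : ℕ) (b : Fin N → Bool) (A : Fin N × Fin N) (C : Fin N) : ℕ :=
  (pos A.1 - pos C + (M - label M b C) + 1) / 2

/-- `d_{2,A}`, for an arc `A` to the right of the star. -/
def d2 {N : ℕ} (M : ℕ) (b : Fin N → Bool) (A : Fin N × Fin N) : ℕ :=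
  (pos A.1 - markedPos M b 1 + M) / 2

def d3 {N : ℕ} (A : Fin N × Fin N) : ℕ := N - pos A.2

/-- `d_{4,C}`, for a down arrow `C` with an integer. -/
def d4 {N : ℕ} (M : ℕ) (b : Fin N → Bool) (C : Fin N) : ℕ :=
  (markedPos M b M - pos C + (M - label M b C)) / 2 + 1

/-- `d_{5,E}`, for a dashed arc `E`. -/
def d5 {N : ℕ} (M : ℕ) (b : Fin N → Bool) (E : Fin N × Fin N) : ℕ :=
  (markedPos M b M - pos E.1 + M + 1) / 2

/-- `h_A` for `A ∈ S_W`: the number of arcs in `S_W` to the right of `A` or outside of `A`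
(including `A`), plus the number of dashed arcs to the right of `A`. -/
def hgt {N : ℕ} (M : ℕ) (b : Fin N → Bool) (A : Fin N × Fin N) : ℕ :=
  ((setSW M b).filter fun B => A.2 < B.1 ∨ (B.1 ≤ A.1 ∧ A.2 ≤ B.2)).card
    + ((dashed M b).filter fun E => A.2 < E.1).card

/-- Left ends of the unpaired up arrows, the unpaired down arrow, the arcs, the dashed arcs and the
down arrows with an integer `2 ≤ p ≤ M`. -/
def leftItems {N : ℕ} (M : ℕ) (b : Fin N → Bool) : Finset (Fin N) :=
  ups b ∪ unpaired M b ∪ (arcs b).image Prod.fst ∪ (dashed M b).image Prod.fst ∪ setU M b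

/-- The number, in the enumeration of these items from left to right (from outside to inside for
nested arcs), of the item with left end `i`. -/
def leftNum {N : ℕ} (M : ℕ) (b : Fin N → Bool) (i : Fin N) : ℕ :=
  ((leftItems M b).filter fun k => k ≤ i).card

/-- Left ends of the arcs, the dashed arcs, the down arrows with an integer `2 ≤ p ≤ M` and the
down arrow with a star. -/
def rightItems {N : ℕ} (M : ℕ) (b : Fin N → Bool) : Finset (Fin N) :=
  (arcs b).image Prod.fst ∪ (dashed M b).image Prod.fst ∪ setU M b ∪ star M b

/-- The number, in the enumeration of these items from right to left (from inside to outside for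
nested arcs), of the item with left end `i`. -/
def rightNum {N : ℕ} (M : ℕ) (b : Fin N → Bool) (i : Fin N) : ℕ :=
  ((rightItems M b).filter fun k => i ≤ k).card

/-! ### The component of `Ψ` -/

def N6 {K : Type*} [Field K] (q : K) {N : ℕ} (M : ℕ) (b : Fin N → Bool) : K :=
  if (setV M b).card = M ∧ N1 M b = 0 then qInt q (N5 M b) / qInt q (N4 M b) else 1

def N7 {K : Type*} [Field K] (q : K) {N : ℕ} (M : ℕ) (b : Fin N → Bool) : K :=
  ∏ C ∈ setU M b, ∏ A ∈ outer M b ∩ setSR M b,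
    qInt q (d1 M b A C) / qInt q (d1 M b A C + size A)

def N8 {K : Type*} [Field K] (q : K) {N : ℕ} (M : ℕ) (b : Fin N → Bool) : K :=
  if (setV M b).card = M then
    ∏ A ∈ outer M b ∩ setSR M b,
      ((∏ i ∈ Finset.range (N3 M b + 1),
          qInt q (d2 M b A + i) / qInt q (d2 M b A + size A + i)) *
        ∏ A' ∈ setSW M b,
          qInt q (d2 M b A + size A + hgt M b A') / qInt q (d2 M b A + hgt M b A'))
  else 1

def N9 {K : Type*} [Field K] (q : K) {N : ℕ} (M : ℕ) (b : Fin N → Bool) : K :=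
  if N1 M b = 1 then
    ∏ A ∈ outer M b ∩ setSW M b, qInt q (d3 A + size A + M) / qInt q (d3 A + 2 * size A + M)
  else
    ∏ A ∈ outer M b ∩ (setSW M b ∪ setSL M b),
      qInt q (d3 A + size A + M) / qInt q (d3 A + 2 * size A + M)

def N10 {K : Type*} [Field K] (q : K) {N : ℕ} (M : ℕ) (b : Fin N → Bool) : K :=
  if N1 M b = 1 then
    (∏ C ∈ setV' M b, (qInt q (d4 M b C))⁻¹) * ∏ E ∈ dashed M b, (qInt q (d5 M b E))⁻¹
  else if dashed M b = ∅ then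
    ∏ C ∈ setU' M b, (qInt q (d4 M b C))⁻¹
  else
    (∏ C ∈ setV' M b, (qInt q (d4 M b C))⁻¹) * ∏ E ∈ setT' M b, (qInt q (d5 M b E))⁻¹

/-- The factor of the unpaired down arrow is present only if there is such an arrow. -/
def N11 {K : Type*} [Field K] (q : K) {N : ℕ} (M : ℕ) (b : Fin N → Bool) : K :=
  (∏ u ∈ unpaired M b, qInt q (leftNum M b u)) *
    ((∏ A ∈ arcs b, qInt q (leftNum M b A.1)) *
      (∏ E ∈ dashed M b, qInt q (leftNum M b E.1)) *
      ∏ C ∈ setU M b, qInt q (leftNum M b C))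

def N12 {K : Type*} [Field K] (q : K) {N : ℕ} (M : ℕ) (b : Fin N → Bool) : K :=
  (∏ i ∈ Finset.Icc 1 (N2 M b), qSym q (i + M - 1)) /
    ((∏ E ∈ dashed M b, qSym q (rightNum M b E.1)) *
      ∏ C ∈ setV M b \ setU M b, qSym q (rightNum M b C))

/-- The component `Ψ_D` of `Ψ`, where `D` is the diagram of type BI of the binary string `b`, with
parameter `Q = q^M`. -/
def psi {K : Type*} [Field K] (q : K) {N : ℕ} (M : ℕ) (b : Fin N → Bool) : K :=
  (∏ A ∈ arcs b, (qInt q (size A))⁻¹) * N6 q M b * N7 q M b * N8 q M b * N9 q M b * N10 q M b *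
    N11 q M b * N12 q M b

/-- `d_D = ∑_j (j + M - 1)`, summed over the positions `j`, counted from the right and starting
with `1`, of the letters `+` of the binary string. -/
def degD {N : ℕ} (M : ℕ) (b : Fin N → Bool) : ℕ :=
  ∑ i ∈ Finset.univ.filter (fun i => b i = true), (N - (i : ℕ) + M - 1)

/-! ### Laurent polynomials as rational functions -/

/-- The variable `q` of `ℂ(q)`, as a unit. -/
noncomputable def qUnit : (RatFunc ℂ)ˣ := Units.mk0 RatFunc.X RatFunc.X_ne_zero

/-- The embedding of `ℕ[q, q⁻¹]` into `ℂ(q)`. -/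
noncomputable def ofLaurent : LaurentPolynomial ℕ →+* RatFunc ℂ :=
  LaurentPolynomial.eval₂ (Nat.castRingHom (RatFunc ℂ)) qUnit

end TypeBI

namespace TypeBI

open Finset Polynomial

/-! ### Quantum integers -/

section Quantum

variable {K : Type*} [Field K] {q : K}

@[simp] lemma qInt_zero : qInt q 0 = 0 := by simp [qInt]

@[simp] lemma qInt_one : qInt q 1 = 1 := by simp [qInt]

lemma qInt_add (hq : q ≠ 0) (m n : ℕ) :
    qInt q (m + n) = q ^ (m : ℤ) * qInt q n + q ^ (-(n : ℤ)) * qInt q m := by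
  rw [add_comm m n]
  unfold qInt
  rw [sum_range_add, mul_sum, mul_sum]
  congr 1 <;> refine sum_congr rfl fun i _ => ?_ <;> rw [← zpow_add₀ hq] <;> congr 1 <;>
    push_cast <;> ring

lemma qInt_two_mul (hq : q ≠ 0) (n : ℕ) : qInt q (2 * n) = qInt q n * qSym q n := by
  rw [two_mul, qInt_add hq, qSym]; ring

lemma qInt_inv (n : ℕ) : qInt q⁻¹ n = qInt q n := by
  unfold qInt
  rw [← sum_range_reflect]
  refine sum_congr rfl fun i hi => ?_
  rw [mem_range] at hi
  rw [inv_zpow', Nat.cast_sub (by omega), Nat.cast_sub (by omega)]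
  congr 1; push_cast; ring

lemma qSym_inv (n : ℕ) : qSym q⁻¹ n = qSym q n := by
  simp [qSym, add_comm]

/-- The quantum factorial `[n]!`. -/
def qFact (q : K) (n : ℕ) : K := ∏ t ∈ range n, qInt q (t + 1)

@[simp] lemma qFact_zero : qFact q 0 = 1 := by simp [qFact]

lemma qFact_succ (n : ℕ) : qFact q (n + 1) = qFact q n * qInt q (n + 1) := prod_range_succ _ _

/-- The product `[x+1] ⋯ [x+m]`. -/
def qRise (q : K) (x m : ℕ) : K := ∏ t ∈ range m, qInt q (x + t + 1)

lemma qFact_mul_qRise (x m : ℕ) : qFact q x * qRise q x m = qFact q (x + m) := by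
  rw [qFact, qFact, qRise, prod_range_add]

@[simp] lemma qRise_zero_left (m : ℕ) : qRise q 0 m = qFact q m := by simp [qRise, qFact]

@[simp] lemma qRise_zero (x : ℕ) : qRise q x 0 = 1 := by simp [qRise]

lemma qRise_add (x m n : ℕ) : qRise q x (m + n) = qRise q x m * qRise q (x + m) n := by
  simp only [qRise, prod_range_add]
  congr 1
  exact prod_congr rfl fun t _ => by congr 1; omega

lemma qRise_succ (x m : ℕ) : qRise q x (m + 1) = qRise q x m * qInt q (x + m + 1) :=
  prod_range_succ _ _

lemma qRise_succ' (x m : ℕ) : qRise q x (m + 1) = qInt q (x + 1) * qRise q (x + 1) m := by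
  rw [add_comm m 1, qRise_add]; simp [qRise]

/-- The product of `q^j + q^{-j}` over `x < j ≤ x + m`. -/
def symRise (q : K) (x m : ℕ) : K := ∏ t ∈ range m, qSym q (x + t + 1)

@[simp] lemma symRise_zero (x : ℕ) : symRise q x 0 = 1 := by simp [symRise]

lemma symRise_add (x m n : ℕ) : symRise q x (m + n) = symRise q x m * symRise q (x + m) n := by
  simp only [symRise, prod_range_add]
  congr 1
  exact prod_congr rfl fun t _ => by congr 1; omega

lemma symRise_succ (x m : ℕ) : symRise q x (m + 1) = symRise q x m * qSym q (x + m + 1) :=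
  prod_range_succ _ _

/-- The quantum binomial coefficient `[x+m]! / ([x]! [m]!)`. -/
def qBin (q : K) (x m : ℕ) : K := qRise q x m / qFact q m

end Quantum

/-! ### Rational functions in `ℕ[q, q⁻¹]` with leading coefficient one -/

/-- The embedding of `ℕ[q]` into `ℂ(q)`. -/
noncomputable def ofPoly : ℕ[X] →+* RatFunc ℂ :=
  eval₂RingHom (Nat.castRingHom (RatFunc ℂ)) RatFunc.X

@[simp] lemma ofPoly_X : ofPoly X = RatFunc.X := by simp [ofPoly]

lemma ofPoly_eq (p : ℕ[X]) :
    ofPoly p = algebraMap ℂ[X] (RatFunc ℂ) (p.map (Nat.castRingHom ℂ)) := by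
  have : ofPoly = (algebraMap ℂ[X] (RatFunc ℂ)).comp (mapRingHom (Nat.castRingHom ℂ)) := by
    ext <;> simp
  rw [this]; rfl

lemma ofPoly_injective : Function.Injective ofPoly := fun p p' h => by
  rw [ofPoly_eq, ofPoly_eq] at h
  exact map_injective _ Nat.cast_injective (RatFunc.algebraMap_injective ℂ h)

/-- `f` is a Laurent polynomial in `q` with coefficients in `ℕ` and leading term `q^d`. -/
def Good (f : RatFunc ℂ) (d : ℤ) : Prop :=
  ∃ p : ℕ[X], p.Monic ∧ f = ofPoly p * RatFunc.X ^ (d - p.natDegree)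

namespace Good

variable {f g : RatFunc ℂ} {d e : ℤ}

lemma ne_zero (hf : Good f d) : f ≠ 0 := by
  obtain ⟨p, hp, rfl⟩ := hf
  refine mul_ne_zero ?_ (zpow_ne_zero _ RatFunc.X_ne_zero)
  rw [Ne, map_eq_zero_iff _ ofPoly_injective]
  exact hp.ne_zero

lemma zpow (k : ℤ) : Good (RatFunc.X ^ k) k := ⟨1, monic_one, by simp⟩

lemma one : Good 1 0 := ⟨1, monic_one, by simp⟩

lemma congr (hf : Good f d) (h : f = g) (h' : d = e) : Good g e := h ▸ h' ▸ hf

lemma mul (hf : Good f d) (hg : Good g e) : Good (f * g) (d + e) := by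
  obtain ⟨p, hp, rfl⟩ := hf
  obtain ⟨p', hp', rfl⟩ := hg
  refine ⟨p * p', hp.mul hp', ?_⟩
  rw [map_mul, hp.natDegree_mul hp', mul_mul_mul_comm, ← zpow_add₀ RatFunc.X_ne_zero]
  congr 2; push_cast; ring

lemma prod {ι : Type*} (s : Finset ι) (F : ι → RatFunc ℂ) (D : ι → ℤ)
    (h : ∀ i ∈ s, Good (F i) (D i)) : Good (∏ i ∈ s, F i) (∑ i ∈ s, D i) := by
  classical
  induction s using Finset.induction_on with
  | empty => simpa using one
  | insert a s ha ih =>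
    rw [prod_insert ha, sum_insert ha]
    exact (h a (mem_insert_self _ _)).mul (ih fun i hi => h i (mem_insert_of_mem hi))

lemma add (hf : Good f d) (hg : Good g e) (h : e < d) : Good (f + g) d := by
  obtain ⟨p, hp, hf⟩ := hf
  obtain ⟨p', hp', hg⟩ := hg
  obtain ⟨k, hk⟩ := Int.eq_ofNat_of_zero_le (sub_nonneg.2 h.le)
  set a := p.natDegree
  set b := p'.natDegree
  have h1 : (p * X ^ (b + k)).natDegree = a + (b + k) := by
    rw [hp.natDegree_mul (monic_X_pow _), natDegree_X_pow]
  have h2 : (p' * X ^ a).natDegree = b + a := by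
    rw [hp'.natDegree_mul (monic_X_pow _), natDegree_X_pow]
  have hlt : (p' * X ^ a).natDegree < (p * X ^ (b + k)).natDegree := by omega
  refine ⟨p * X ^ (b + k) + p' * X ^ a,
    (hp.mul (monic_X_pow _)).add_of_left (degree_lt_degree hlt), ?_⟩
  rw [natDegree_add_eq_left_of_natDegree_lt hlt, h1, map_add, map_mul, map_mul, map_pow, map_pow,
    ofPoly_X, add_mul, mul_assoc, mul_assoc, ← zpow_natCast, ← zpow_natCast,
    ← zpow_add₀ RatFunc.X_ne_zero, ← zpow_add₀ RatFunc.X_ne_zero, hf, hg]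
  congr 3 <;> push_cast <;> linarith

end Good

local notation "𝐪" => (RatFunc.X : RatFunc ℂ)

lemma Good.qInt {n : ℕ} (hn : 0 < n) : Good (qInt 𝐪 n) (n - 1) := by
  induction n, hn using Nat.le_induction with
  | base => simpa using Good.one
  | succ n hn ih =>
    rw [qInt_add RatFunc.X_ne_zero, qInt_one, mul_one]
    exact ((Good.zpow n).add ((Good.zpow _).mul ih) (by push_cast; omega)).congr rfl
      (by push_cast; ring)

lemma qInt_ne_zero {n : ℕ} (hn : 0 < n) : qInt 𝐪 n ≠ 0 := (Good.qInt hn).ne_zero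

lemma Good.qSym {n : ℕ} (hn : 0 < n) : Good (qSym 𝐪 n) n :=
  (Good.zpow n).add (Good.zpow _) (by omega)

lemma qSym_ne_zero {n : ℕ} (hn : 0 < n) : qSym 𝐪 n ≠ 0 := (Good.qSym hn).ne_zero

lemma qFact_ne_zero (n : ℕ) : qFact 𝐪 n ≠ 0 :=
  prod_ne_zero_iff.2 fun _ _ => qInt_ne_zero (Nat.succ_pos _)

lemma Good.symRise (x m : ℕ) : Good (symRise 𝐪 x m) (∑ t ∈ range m, ((x : ℤ) + t + 1)) :=
  Good.prod _ _ _ fun t _ => (Good.qSym (Nat.succ_pos _)).congr rfl (by push_cast; ring)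

lemma qBin_succ_mul (x m : ℕ) :
    qBin 𝐪 x (m + 1) * qInt 𝐪 (m + 1) = qInt 𝐪 (x + 1) * qBin 𝐪 (x + 1) m := by
  have := qFact_ne_zero m
  have := qInt_ne_zero (Nat.succ_pos m)
  rw [qBin, qBin, qRise_succ', qFact_succ]
  field_simp

lemma Good.qBin (x m : ℕ) : Good (qBin 𝐪 x m) (x * m) := by
  induction m generalizing x with
  | zero => simpa [TypeBI.qBin] using Good.one
  | succ m ihm =>
    induction x with
    | zero =>
      simpa [TypeBI.qBin, div_self (qFact_ne_zero _)] using Good.one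
    | succ x ihx =>
      have h0 := qInt_ne_zero (Nat.succ_pos m)
      have h : TypeBI.qBin 𝐪 (x + 1) (m + 1) =
          𝐪 ^ ((x + 1 : ℕ) : ℤ) * TypeBI.qBin 𝐪 (x + 1) m +
          𝐪 ^ (-((m + 1 : ℕ) : ℤ)) * TypeBI.qBin 𝐪 x (m + 1) := by
        apply mul_right_cancel₀ h0
        have e : TypeBI.qBin 𝐪 (x + 1) (m + 1) * TypeBI.qInt 𝐪 (m + 1) =
            TypeBI.qBin 𝐪 (x + 1) m * TypeBI.qInt 𝐪 ((x + 1) + (m + 1)) := by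
          have := qFact_ne_zero m
          rw [TypeBI.qBin, TypeBI.qBin, qRise_succ, qFact_succ]
          field_simp
          rfl
        rw [e, qInt_add RatFunc.X_ne_zero, add_mul, mul_assoc _ (TypeBI.qBin 𝐪 x (m + 1)),
          qBin_succ_mul]
        ring
      rw [h]
      refine (((Good.zpow _).mul (ihm (x + 1))).add ((Good.zpow _).mul ihx) ?_).congr rfl ?_
      · push_cast; nlinarith
      · push_cast; ring

lemma Good.qBin_mul_div {x : ℕ} (hx : 0 < x) (m : ℕ) :
    Good (TypeBI.qBin 𝐪 x m * TypeBI.symRise 𝐪 x m *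
      (TypeBI.qInt 𝐪 (2 * x + m) / TypeBI.qInt 𝐪 (2 * x + 2 * m)))
      (x * m + ∑ t ∈ range m, ((x : ℤ) + t + 1) - m) := by
  obtain ⟨x, rfl⟩ := Nat.exists_eq_succ_of_ne_zero hx.ne'
  simp only [Nat.succ_eq_add_one]
  rcases m with _ | m
  · simpa [TypeBI.qBin, div_self (qInt_ne_zero (show 0 < 2 * (x + 1) by omega))] using Good.one
  have h1 := qInt_ne_zero (show 0 < x + 1 + m + 1 by omega)
  have h2 := qSym_ne_zero (show 0 < x + 1 + m + 1 by omega)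
  have h3 := qFact_ne_zero (m + 1)
  have h : TypeBI.qBin 𝐪 (x + 1) (m + 1) * TypeBI.symRise 𝐪 (x + 1) (m + 1) *
      (TypeBI.qInt 𝐪 (2 * (x + 1) + (m + 1)) / TypeBI.qInt 𝐪 (2 * (x + 1) + 2 * (m + 1))) =
      (𝐪 ^ ((x + 1 : ℕ) : ℤ) * TypeBI.qBin 𝐪 (x + 1) (m + 1) +
        𝐪 ^ (-((x + 1 + m + 1 : ℕ) : ℤ)) * TypeBI.qBin 𝐪 x (m + 1)) *
      TypeBI.symRise 𝐪 (x + 1) m := by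
    rw [show 2 * (x + 1) + (m + 1) = (x + 1) + (x + 1 + m + 1) by ring,
      show 2 * (x + 1) + 2 * (m + 1) = 2 * (x + 1 + m + 1) by ring,
      qInt_two_mul RatFunc.X_ne_zero, qInt_add RatFunc.X_ne_zero, symRise_succ]
    have e : TypeBI.qBin 𝐪 (x + 1) (m + 1) * TypeBI.qInt 𝐪 (x + 1) =
        TypeBI.qBin 𝐪 x (m + 1) * TypeBI.qInt 𝐪 (x + 1 + m + 1) := by
      rw [TypeBI.qBin, TypeBI.qBin, qRise_succ, qRise_succ']
      field_simp
    field_simp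
    linear_combination (𝐪 ^ (-((x + 1 + m + 1 : ℕ) : ℤ)) * TypeBI.symRise 𝐪 (x + 1) m) * e
  rw [h]
  refine ((((Good.zpow _).mul (Good.qBin _ _)).add ((Good.zpow _).mul (Good.qBin _ _)) ?_).mul
    (Good.symRise _ _)).congr rfl ?_
  · push_cast; nlinarith
  · rw [sum_range_succ]; push_cast; ring

/-! ### Symmetry under `q ↦ q⁻¹` -/

lemma eval₂_X_inv_injective :
    Function.Injective (eval₂RingHom (RatFunc.C : ℂ →+* RatFunc ℂ) 𝐪⁻¹) := by
  rw [injective_iff_map_eq_zero]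
  intro p hp
  let _ : Invertible 𝐪⁻¹ := invertibleOfNonzero (inv_ne_zero RatFunc.X_ne_zero)
  have h := (eval₂_reverse_eq_zero_iff (RatFunc.C : ℂ →+* RatFunc ℂ) 𝐪⁻¹ p).2 hp
  rw [invOf_eq_inv, inv_inv] at h
  have h' : algebraMap ℂ[X] (RatFunc ℂ) p.reverse = 0 := by
    rw [← h, ← RatFunc.algebraMap_X, ← RatFunc.algebraMap_comp_C, ← hom_eval₂, eval₂_C_X]
  rwa [map_eq_zero_iff _ (RatFunc.algebraMap_injective ℂ), reverse_eq_zero] at h'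

/-- The automorphism `q ↦ q⁻¹` of `ℂ(q)`. -/
noncomputable def bar : RatFunc ℂ →+* RatFunc ℂ :=
  RatFunc.liftRingHom (eval₂RingHom (RatFunc.C : ℂ →+* RatFunc ℂ) 𝐪⁻¹)
    (nonZeroDivisors_le_comap_nonZeroDivisors_of_injective _ eval₂_X_inv_injective)

@[simp] lemma bar_X : bar 𝐪 = 𝐪⁻¹ := by
  have h := RatFunc.liftRingHom_algebraMap
    (eval₂RingHom (RatFunc.C : ℂ →+* RatFunc ℂ) 𝐪⁻¹)
    (nonZeroDivisors_le_comap_nonZeroDivisors_of_injective _ eval₂_X_inv_injective) X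
  rw [RatFunc.algebraMap_X] at h
  exact h.trans (by simp)

lemma bar_qInt (n : ℕ) : bar (qInt 𝐪 n) = qInt 𝐪 n := by
  conv_rhs => rw [← qInt_inv]
  simp [qInt]

lemma bar_qSym (n : ℕ) : bar (qSym 𝐪 n) = qSym 𝐪 n := by
  conv_rhs => rw [← qSym_inv]
  simp [qSym]

lemma ofLaurent_toLaurent (p : ℕ[X]) : ofLaurent p.toLaurent = ofPoly p := by
  rw [ofLaurent, LaurentPolynomial.eval₂_toLaurent]; rfl

lemma ofLaurent_T (n : ℤ) : ofLaurent (LaurentPolynomial.T n) = 𝐪 ^ n := by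
  rw [ofLaurent, LaurentPolynomial.eval₂_T]; simp [qUnit]

lemma ofLaurent_injective : Function.Injective ofLaurent := by
  intro P P' h
  obtain ⟨n, p, hp⟩ := P.exists_T_pow
  obtain ⟨n', p', hp'⟩ := P'.exists_T_pow
  have h1 : (p * X ^ n').toLaurent = P * LaurentPolynomial.T (n + n') := by
    rw [map_mul, hp, toLaurent_X_pow, LaurentPolynomial.mul_T_assoc]
  have h2 : (p' * X ^ n).toLaurent = P' * LaurentPolynomial.T (n + n') := by
    rw [map_mul, hp', toLaurent_X_pow, LaurentPolynomial.mul_T_assoc, add_comm]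
  have h3 : p * X ^ n' = p' * X ^ n := by
    apply ofPoly_injective
    rw [← ofLaurent_toLaurent, ← ofLaurent_toLaurent, h1, h2, map_mul, map_mul, h]
  exact (LaurentPolynomial.isUnit_T _).mul_right_cancel (h1.symm.trans ((congrArg _ h3).trans h2))

lemma ofLaurent_invert (P : LaurentPolynomial ℕ) :
    ofLaurent (LaurentPolynomial.invert P) = bar (ofLaurent P) := by
  induction P using LaurentPolynomial.induction_on' with
  | add p p' h h' => simp only [map_add, h, h']
  | C_mul_T n a =>
    simp [ofLaurent_T]

lemma coeff_toLaurent_mul_T (p : ℕ[X]) (k : ℤ) (n : ℕ) :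
    (p.toLaurent * LaurentPolynomial.T k).coeff (k + n) = p.coeff n := by
  rw [LaurentPolynomial.T, AddMonoidAlgebra.coeff_mul_single_eq_coeff_mul (m₂ := (n : ℤ))
    (H := fun m _ => by omega), mul_one, LaurentPolynomial.coeff_toLaurent]
  exact Finsupp.mapDomain_apply Nat.castEmbedding.injective _ _

lemma Good.exists_laurent {f : RatFunc ℂ} {d : ℤ} (hf : Good f d) (hs : bar f = f) :
    ∃ P : LaurentPolynomial ℕ, f = ofLaurent P ∧ LaurentPolynomial.invert P = P ∧
      P.coeff d = 1 ∧ ∀ n : ℤ, d < n → P.coeff n = 0 := by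
  obtain ⟨p, hp, h⟩ := hf
  have hP : f = ofLaurent (p.toLaurent * LaurentPolynomial.T (d - p.natDegree)) := by
    rw [map_mul, ofLaurent_toLaurent, ofLaurent_T, h]
  refine ⟨_, hP, ofLaurent_injective (by rw [ofLaurent_invert, ← hP, hs]), ?_, ?_⟩
  · have := coeff_toLaurent_mul_T p (d - p.natDegree) p.natDegree
    rwa [sub_add_cancel, hp.coeff_natDegree] at this
  · intro n hn
    obtain ⟨k, hk⟩ := Int.eq_ofNat_of_zero_le (show 0 ≤ n - (d - p.natDegree) by omega)
    have := coeff_toLaurent_mul_T p (d - p.natDegree) k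
    rw [← hk, add_sub_cancel] at this
    rw [this, coeff_eq_zero_of_natDegree_lt]
    omega

end TypeBI
namespace TypeBI

open Finset

/-! ### The matching of parentheses -/

section Matching

variable {N : ℕ} {b : Fin N → Bool}

/-- Number of down arrows minus number of up arrows among the first `i` arrows. -/
def height (b : Fin N → Bool) (i : ℕ) : ℤ :=
  ∑ l ∈ univ.filter (fun l : Fin N => (l : ℕ) < i), if b l then -1 else 1

lemma height_succ (b : Fin N → Bool) (l : Fin N) :
    height b (l + 1) = height b l + if b l then -1 else 1 := by
  have : (univ.filter fun k : Fin N => (k : ℕ) < l + 1) =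
      insert l (univ.filter fun k : Fin N => (k : ℕ) < l) := by
    ext k; simp only [mem_filter, mem_univ, true_and, mem_insert, Fin.ext_iff]; omega
  rw [height, this, sum_insert (by simp), height, add_comm]

lemma excess_eq {i k : Fin N} (h : i ≤ k) : excess b i k = height b (k + 1) - height b i := by
  rw [eq_sub_iff_add_eq, excess, height, height, ← sum_union]
  · refine sum_congr ?_ fun _ _ => rfl
    ext l
    simp only [mem_union, mem_Icc, mem_filter, mem_univ, true_and, Fin.le_def] at h ⊢
    omega
  · rw [disjoint_left]
    intro l
    simp only [mem_Icc, mem_filter, mem_univ, true_and, Fin.le_def]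
    omega

lemma mem_arcs {A : Fin N × Fin N} : A ∈ arcs b ↔ (A.1 : ℕ) < A.2 ∧ b A.1 = false ∧
    b A.2 = true ∧ (∀ k : ℕ, A.1 < k → k ≤ A.2 → height b A.1 < height b k) ∧
    height b (A.2 + 1) = height b A.1 := by
  simp only [arcs, mem_filter, mem_univ, true_and]
  refine and_congr_right fun h => and_congr_right fun _ => and_congr_right fun _ =>
    and_congr ?_ ?_
  · constructor
    · intro H k hk hk'
      have := H ⟨k - 1, by omega⟩ (by simp only [Fin.le_def]; omega)
        (by simp only [Fin.lt_def]; omega)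
      rw [excess_eq (by simp only [Fin.le_def]; omega)] at this
      simp only [show k - 1 + 1 = k by omega] at this
      omega
    · intro H k hk hk'
      rw [excess_eq hk]
      have := H (k + 1) (by simp only [Fin.le_def] at hk; omega)
        (by simp only [Fin.lt_def] at hk'; omega)
      omega
  · rw [excess_eq h.le]
    omega

lemma arc_lt {A : Fin N × Fin N} (hA : A ∈ arcs b) : (A.1 : ℕ) < A.2 := (mem_arcs.1 hA).1

lemma arc_fst_false {A : Fin N × Fin N} (hA : A ∈ arcs b) : b A.1 = false := (mem_arcs.1 hA).2.1

lemma arc_snd_true {A : Fin N × Fin N} (hA : A ∈ arcs b) : b A.2 = true := (mem_arcs.1 hA).2.2.1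

lemma arc_fst_inj {A B : Fin N × Fin N} (hA : A ∈ arcs b) (hB : B ∈ arcs b)
    (h : (A.1 : ℕ) = B.1) : A = B := by
  obtain ⟨hA1, -, -, hA2, hA3⟩ := mem_arcs.1 hA
  obtain ⟨hB1, -, -, hB2, hB3⟩ := mem_arcs.1 hB
  refine Prod.ext (Fin.ext h) (Fin.ext ?_)
  rcases lt_trichotomy (A.2 : ℕ) B.2 with h' | h' | h'
  · have := hB2 (A.2 + 1) (by omega) (by omega)
    rw [hA3, h] at this; omega
  · exact h'
  · have := hA2 (B.2 + 1) (by omega) (by omega)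
    rw [hB3, h] at this; omega

lemma arc_snd_inj {A B : Fin N × Fin N} (hA : A ∈ arcs b) (hB : B ∈ arcs b)
    (h : (A.2 : ℕ) = B.2) : A = B := by
  refine arc_fst_inj hA hB ?_
  obtain ⟨hA1, -, -, hA2, hA3⟩ := mem_arcs.1 hA
  obtain ⟨hB1, -, -, hB2, hB3⟩ := mem_arcs.1 hB
  rw [h] at hA3
  rcases lt_trichotomy (A.1 : ℕ) B.1 with h' | h' | h'
  · have := hA2 B.1 h' (by omega)
    omega
  · exact h'
  · have := hB2 A.1 h' (by omega)
    omega

lemma arc_nested {A B : Fin N × Fin N} (hA : A ∈ arcs b) (hB : B ∈ arcs b)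
    (h : (A.1 : ℕ) < B.1) (h' : (B.1 : ℕ) ≤ A.2) : (B.2 : ℕ) < A.2 := by
  by_contra! H
  rcases H.eq_or_lt with H | H
  · rw [arc_snd_inj hA hB H] at h; omega
  · obtain ⟨hA1, -, -, hA2, hA3⟩ := mem_arcs.1 hA
    obtain ⟨hB1, -, -, hB2, hB3⟩ := mem_arcs.1 hB
    have h1 := hA2 B.1 h h'
    have h2 := hB2 (A.2 + 1) (by omega) (by omega)
    omega

lemma arc_ends_ne {A B : Fin N × Fin N} (hA : A ∈ arcs b) (hB : B ∈ arcs b) :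
    (A.1 : ℕ) ≠ B.2 := fun h => by
  have := arc_fst_false hA
  rw [Fin.ext h, arc_snd_true hB] at this
  exact Bool.noConfusion this

lemma downs_false {d : Fin N} (hd : d ∈ downs b) : b d = false := (mem_filter.1 hd).2.1

lemma downs_ne_fst {d : Fin N} (hd : d ∈ downs b) {A : Fin N × Fin N} (hA : A ∈ arcs b) :
    (A.1 : ℕ) ≠ d := fun h => (mem_filter.1 hd).2.2 A hA (Fin.ext h)

lemma downs_ne_snd {d : Fin N} (hd : d ∈ downs b) {A : Fin N × Fin N} (hA : A ∈ arcs b) :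
    (A.2 : ℕ) ≠ d := fun h => by
  have := downs_false hd
  rw [← Fin.ext h, arc_snd_true hA] at this
  exact Bool.noConfusion this

lemma ups_true {u : Fin N} (hu : u ∈ ups b) : b u = true := (mem_filter.1 hu).2.1

lemma ups_ne_snd {u : Fin N} (hu : u ∈ ups b) {A : Fin N × Fin N} (hA : A ∈ arcs b) :
    (A.2 : ℕ) ≠ u := fun h => (mem_filter.1 hu).2.2 A hA (Fin.ext h)

lemma ups_ne_fst {u : Fin N} (hu : u ∈ ups b) {A : Fin N × Fin N} (hA : A ∈ arcs b) :
    (A.1 : ℕ) ≠ u := fun h => by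
  have := ups_true hu
  rw [← Fin.ext h, arc_fst_false hA] at this
  exact Bool.noConfusion this

lemma ups_ne_downs {u d : Fin N} (hu : u ∈ ups b) (hd : d ∈ downs b) : (u : ℕ) ≠ d := fun h => by
  have := ups_true hu
  rw [Fin.ext h, downs_false hd] at this
  exact Bool.noConfusion this

lemma up_or_arc {l : Fin N} (h : b l = true) : l ∈ ups b ∨ ∃ A ∈ arcs b, A.2 = l := by
  by_contra! H
  exact H.1 (mem_filter.2 ⟨mem_univ _, h, H.2⟩)

lemma down_or_arc {l : Fin N} (h : b l = false) : l ∈ downs b ∨ ∃ A ∈ arcs b, A.1 = l := by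
  by_contra! H
  exact H.1 (mem_filter.2 ⟨mem_univ _, h, H.2⟩)

lemma height_downs {d : Fin N} (hd : d ∈ downs b) {k : ℕ} (h : d < k) (hk : k ≤ N) :
    height b d < height b k := by
  by_contra! H
  have hex : ∃ k : ℕ, d < k ∧ k ≤ N ∧ height b k ≤ height b d := ⟨k, h, hk, H⟩
  obtain ⟨h1, h2, h3⟩ := Nat.find_spec hex
  set m := Nat.find hex
  have hd' := height_succ b d
  rw [downs_false hd] at hd'
  have hm : m ≠ d + 1 := fun e => by
    rw [e, hd'] at h3; simp at h3
  have hmin : ∀ k : ℕ, d < k → k ≤ m - 1 → height b d < height b k := fun k hk hk' => by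
    have := Nat.find_min hex (show k < m by omega)
    push Not at this
    exact this hk (by omega)
  have hlast := height_succ b ⟨m - 1, by omega⟩
  simp only [show m - 1 + 1 = m by omega] at hlast
  have := hmin (m - 1) (by omega) le_rfl
  have hb : b ⟨m - 1, by omega⟩ = true := by
    by_contra hb
    rw [if_neg hb] at hlast; omega
  rw [if_pos hb] at hlast
  refine downs_ne_fst hd (A := (d, ⟨m - 1, by omega⟩)) (mem_arcs.2 ⟨?_, downs_false hd, hb,
    hmin, ?_⟩) rfl
  · simp only; omega
  · simp only [show m - 1 + 1 = m by omega]; omega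

lemma height_ups {u : Fin N} (hu : u ∈ ups b) {i : ℕ} (h : i ≤ u) :
    height b (u + 1) < height b i := by
  by_contra! H
  have hs := Nat.findGreatest_spec (P := fun i => height b i ≤ height b (u + 1)) h H
  have hle := Nat.findGreatest_le (P := fun i => height b i ≤ height b (u + 1)) (u : ℕ)
  have hmax : ∀ k : ℕ, Nat.findGreatest (fun i => height b i ≤ height b (u + 1)) u < k → k ≤ u →
      height b (u + 1) < height b k := fun k hk hk' => by
    simpa using Nat.findGreatest_is_greatest hk hk'
  set m := Nat.findGreatest (fun i => height b i ≤ height b (u + 1)) u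
  have hu' := height_succ b u
  rw [ups_true hu, if_pos rfl] at hu'
  have hm : m ≠ u := fun e => by rw [e] at hs; omega
  have hm' := height_succ b ⟨m, by omega⟩
  have := hmax (m + 1) (by omega) (by omega)
  simp only at hm'
  have hb : b ⟨m, by omega⟩ = false := by
    by_contra hb
    rw [Bool.not_eq_false] at hb
    rw [if_pos hb] at hm'; omega
  rw [hb] at hm'
  simp only [Bool.false_eq_true, if_false] at hm'
  refine ups_ne_snd hu (A := (⟨m, by omega⟩, u)) (mem_arcs.2 ⟨by simp only; omega, hb,
    ups_true hu, fun k hk hk' => ?_, by simp only; omega⟩) rfl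
  have := hmax k hk hk'
  simp only; omega

lemma ups_lt_downs {u d : Fin N} (hu : u ∈ ups b) (hd : d ∈ downs b) : (u : ℕ) < d := by
  by_contra! H
  have h1 := height_ups hu H
  have h2 := height_downs hd (k := u + 1) (by omega) u.2
  omega

lemma downs_not_inside {d : Fin N} (hd : d ∈ downs b) {A : Fin N × Fin N} (hA : A ∈ arcs b)
    (h : (A.1 : ℕ) < d) : (A.2 : ℕ) < d := by
  by_contra! H
  obtain ⟨-, -, -, h1, h2⟩ := mem_arcs.1 hA
  have h3 := h1 d h H
  have h4 := height_downs hd (k := A.2 + 1) (by omega) A.2.2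
  omega

lemma ups_not_inside {u : Fin N} (hu : u ∈ ups b) {A : Fin N × Fin N} (hA : A ∈ arcs b)
    (h : (A.1 : ℕ) < u) : (A.2 : ℕ) < u := by
  by_contra! H
  obtain ⟨-, -, -, h1, h2⟩ := mem_arcs.1 hA
  have h3 := height_ups hu h.le
  have := ups_ne_snd hu hA
  have h4 := h1 (u + 1) (by omega) (by omega)
  omega

/-! ### Intervals which are unions of components of the diagram -/

/-- No arc joins a position in `[i, j)` to a position outside of `[i, j)`. -/
structure Closed (b : Fin N → Bool) (i j : ℕ) : Prop where
  le : i ≤ j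
  le_card : j ≤ N
  iff : ∀ A ∈ arcs b, (i ≤ (A.1 : ℕ) ∧ (A.1 : ℕ) < j) ↔ (i ≤ (A.2 : ℕ) ∧ (A.2 : ℕ) < j)

lemma Closed.univ (b : Fin N → Bool) : Closed b 0 N := ⟨by simp, le_rfl, fun A _ => by simp⟩

lemma Closed.inside {A : Fin N × Fin N} (hA : A ∈ arcs b) : Closed b (A.1 + 1) A.2 :=
  ⟨arc_lt hA, A.2.2.le, fun B hB => by
    have h1 := arc_lt hB
    constructor
    · rintro ⟨h2, h3⟩
      exact ⟨by omega, arc_nested hA hB (by omega) h3.le⟩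
    · rintro ⟨h2, h3⟩
      refine ⟨?_, by omega⟩
      by_contra! H
      rcases (Nat.lt_succ_iff.1 H).eq_or_lt with h | h
      · rw [arc_fst_inj hB hA h] at h3; omega
      · have := arc_nested hB hA h (by omega); omega⟩

lemma Closed.down {d : Fin N} (hd : d ∈ downs b) : Closed b (d + 1) N :=
  ⟨d.2, le_rfl, fun A hA => by
    have h1 := downs_not_inside hd hA
    have h2 := arc_lt hA
    have h3 := downs_ne_fst hd hA
    omega⟩

lemma Closed.down' {d : Fin N} (hd : d ∈ downs b) : Closed b d N :=
  ⟨d.2.le, le_rfl, fun A hA => by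
    have h1 := downs_not_inside hd hA
    have h2 := arc_lt hA
    omega⟩

lemma Closed.up {u : Fin N} (hu : u ∈ ups b) : Closed b (u + 1) N :=
  ⟨u.2, le_rfl, fun A hA => by
    have h1 := ups_not_inside hu hA
    have h2 := arc_lt hA
    have h3 := ups_ne_fst hu hA
    omega⟩

lemma Closed.diff {i j k : ℕ} (hij : i ≤ j) (hjk : j ≤ k) (h : Closed b i k) (h' : Closed b j k) :
    Closed b i j :=
  ⟨hij, hjk.trans h.le_card, fun A hA => by
    have h1 := h.iff A hA
    have h2 := h'.iff A hA
    omega⟩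

theorem Closed.induction {P : ℕ → ℕ → Prop} (nil : ∀ i, i ≤ N → P i i)
    (up : ∀ u ∈ ups b, ∀ j, Closed b u j → Closed b (u + 1) j → P (u + 1) j → P u j)
    (down : ∀ d ∈ downs b, ∀ j, Closed b d j → Closed b (d + 1) j → P (d + 1) j → P d j)
    (arc : ∀ A ∈ arcs b, ∀ j, Closed b A.1 j → Closed b (A.1 + 1) A.2 → Closed b (A.2 + 1) j →
      P (A.1 + 1) A.2 → P (A.2 + 1) j → P A.1 j) {i j : ℕ} (h : Closed b i j) : P i j := by
  induction hn : j - i using Nat.strong_induction_on generalizing i j with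
  | _ n ih =>
  rcases h.le.eq_or_lt with rfl | hij
  · exact nil _ h.le_card
  have hiN : i < N := hij.trans_le h.le_card
  have hstep : ∀ l : Fin N, (l : ℕ) = i → (∀ A ∈ arcs b, (A.1 : ℕ) ≠ l) →
      (∀ A ∈ arcs b, (A.2 : ℕ) ≠ l) → Closed b (l + 1) j := fun l hl h1 h2 =>
    ⟨by omega, h.le_card, fun A hA => by
      have := h.iff A hA
      have := h1 A hA
      have := h2 A hA
      omega⟩
  rcases hb : b ⟨i, hiN⟩ with _ | _
  · rcases down_or_arc hb with hd | ⟨A, hA, hA'⟩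
    · have hc := hstep _ rfl (fun A hA => downs_ne_fst hd hA) (fun A hA => downs_ne_snd hd hA)
      exact down _ hd j h hc (ih _ (by simp only; omega) hc rfl)
    · obtain rfl : (A.1 : ℕ) = i := congrArg Fin.val hA'
      have h1 := (h.iff A hA).1 ⟨le_rfl, hij⟩
      have hc1 := Closed.inside hA
      have hc2 : Closed b (A.2 + 1) j := ⟨by omega, h.le_card, fun B hB => by
        have e1 := h.iff B hB
        have e2 := arc_lt hB
        have e3 := hc1.iff B hB
        have e4 := arc_lt hA
        have e5 : (B.1 : ℕ) = A.1 → (B.2 : ℕ) = A.2 := fun e => by rw [arc_fst_inj hB hA e]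
        have e6 := arc_ends_ne hB hA
        omega⟩
      exact arc A hA j h hc1 hc2 (ih _ (by have := arc_lt hA; omega) hc1 rfl)
        (ih _ (by have := arc_lt hA; omega) hc2 rfl)
  · rcases up_or_arc hb with hu | ⟨A, hA, hA'⟩
    · have hc := hstep _ rfl (fun A hA => ups_ne_fst hu hA) (fun A hA => ups_ne_snd hu hA)
      exact up _ hu j h hc (ih _ (by simp only; omega) hc rfl)
    · have e : (A.2 : ℕ) = i := congrArg Fin.val hA'
      have h1 := (h.iff A hA).2 ⟨e.ge, by omega⟩
      have h2 := arc_lt hA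
      omega

end Matching

/-! ### Products over the elements lying in an interval -/

section Seg

variable {α M : Type*} [CommMonoid M] {key : α → ℕ} {s : Finset α} {f : α → M}

/-- The product of `f` over the elements of `s` located in `[i, j)`. -/
@[to_additive]
def segProd (key : α → ℕ) (s : Finset α) (f : α → M) (i j : ℕ) : M :=
  ∏ a ∈ s with i ≤ key a ∧ key a < j, f a

@[to_additive]
lemma segProd_split {i j k : ℕ} (h : i ≤ j) (h' : j ≤ k) :
    segProd key s f i k = segProd key s f i j * segProd key s f j k := by
  classical
  rw [segProd, segProd, segProd, ← prod_union]
  · refine prod_congr ?_ fun _ _ => rfl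
    ext a; simp only [mem_filter, mem_union, ← and_or_left]
    refine and_congr_right fun _ => ?_
    omega
  · rw [disjoint_left]; intro a; simp only [mem_filter]; omega

@[to_additive]
lemma segProd_eq_one {i j : ℕ} (h : ∀ a ∈ s, ¬(i ≤ key a ∧ key a < j)) :
    segProd key s f i j = 1 := by
  rw [segProd, filter_false_of_mem h, prod_empty]

@[to_additive]
lemma segProd_eq_prod {i j : ℕ} (h : ∀ a ∈ s, i ≤ key a ∧ key a < j) :
    segProd key s f i j = ∏ a ∈ s, f a := by
  rw [segProd, filter_true_of_mem h]

@[to_additive]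
lemma segProd_succ_of_ne {i j : ℕ} (hij : i < j) (h : ∀ a ∈ s, key a ≠ i) :
    segProd key s f i j = segProd key s f (i + 1) j := by
  rw [segProd_split (Nat.le_succ i) hij, segProd_eq_one (j := i + 1), one_mul]
  intro a ha
  have := h a ha
  omega

@[to_additive]
lemma segProd_succ_of_mem {a : α} {i j : ℕ} (ha : a ∈ s) (hi : key a = i) (hij : i < j)
    (h : ∀ c ∈ s, key c = key a → c = a) :
    segProd key s f i j = f a * segProd key s f (i + 1) j := by
  rw [segProd_split (Nat.le_succ i) hij]
  congr 1
  rw [segProd, prod_eq_single_of_mem a (by simp [ha, hi])]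
  intro c hc hca
  rw [mem_filter] at hc
  exact absurd (h c hc.1 (by omega)) hca

@[to_additive]
lemma segProd_congr {g : α → M} {i j : ℕ} (h : ∀ a ∈ s, i ≤ key a → key a < j → f a = g a) :
    segProd key s f i j = segProd key s g i j :=
  prod_congr rfl fun a ha => by rw [mem_filter] at ha; exact h a ha.1 ha.2.1 ha.2.2

end Seg

end TypeBI
namespace TypeBI

open Finset

section Peel

variable {N : ℕ} {b : Fin N → Bool} {M : Type*} [CommMonoid M]

/-- The product of `f` over the arcs with left end in `[i, j)`. -/
@[to_additive]
def arcProd (b : Fin N → Bool) (f : Fin N × Fin N → M) (i j : ℕ) : M :=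
  segProd (fun A => (A.1 : ℕ)) (arcs b) f i j

/-- The product of `f` over the unpaired up arrows in `[i, j)`. -/
@[to_additive]
def upProd (b : Fin N → Bool) (f : Fin N → M) (i j : ℕ) : M :=
  segProd Fin.val (ups b) f i j

/-- The product of `f` over the down arrows in `[i, j)` that belong to no arc. -/
@[to_additive]
def downProd (b : Fin N → Bool) (f : Fin N → M) (i j : ℕ) : M :=
  segProd Fin.val (downs b) f i j

/-- The product of `f` over the letters `+` in `[i, j)`. -/
@[to_additive]
def plusProd (b : Fin N → Bool) (f : Fin N → M) (i j : ℕ) : M :=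
  segProd Fin.val (univ.filter fun l => b l = true) f i j

variable {f : Fin N × Fin N → M} {g : Fin N → M} {u d : Fin N} {A : Fin N × Fin N} {i j : ℕ}

@[to_additive]
lemma arcProd_self (i : ℕ) : arcProd b f i i = 1 := segProd_eq_one fun _ _ => by omega

@[to_additive]
lemma upProd_self (i : ℕ) : upProd b g i i = 1 := segProd_eq_one fun _ _ => by omega

@[to_additive]
lemma downProd_self (i : ℕ) : downProd b g i i = 1 := segProd_eq_one fun _ _ => by omega

@[to_additive]
lemma plusProd_self (i : ℕ) : plusProd b g i i = 1 := segProd_eq_one fun _ _ => by omega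

@[to_additive]
lemma arcProd_up (hu : u ∈ ups b) (h : (u : ℕ) < j) : arcProd b f u j = arcProd b f (u + 1) j :=
  segProd_succ_of_ne h fun _ hA => ups_ne_fst hu hA

@[to_additive]
lemma upProd_up (hu : u ∈ ups b) (h : (u : ℕ) < j) :
    upProd b g u j = g u * upProd b g (u + 1) j :=
  segProd_succ_of_mem hu rfl h fun _ _ => Fin.ext

@[to_additive]
lemma downProd_up (hu : u ∈ ups b) (h : (u : ℕ) < j) :
    downProd b g u j = downProd b g (u + 1) j :=
  segProd_succ_of_ne h fun _ hd => (ups_ne_downs hu hd).symm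

@[to_additive]
lemma plusProd_up (hu : u ∈ ups b) (h : (u : ℕ) < j) :
    plusProd b g u j = g u * plusProd b g (u + 1) j :=
  segProd_succ_of_mem (by simp [ups_true hu]) rfl h fun _ _ => Fin.ext

@[to_additive]
lemma arcProd_down (hd : d ∈ downs b) (h : (d : ℕ) < j) :
    arcProd b f d j = arcProd b f (d + 1) j :=
  segProd_succ_of_ne h fun _ hA => downs_ne_fst hd hA

@[to_additive]
lemma upProd_down (hd : d ∈ downs b) (h : (d : ℕ) < j) : upProd b g d j = upProd b g (d + 1) j :=
  segProd_succ_of_ne h fun _ hu => ups_ne_downs hu hd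

@[to_additive]
lemma downProd_down (hd : d ∈ downs b) (h : (d : ℕ) < j) :
    downProd b g d j = g d * downProd b g (d + 1) j :=
  segProd_succ_of_mem hd rfl h fun _ _ => Fin.ext

@[to_additive]
lemma plusProd_down (hd : d ∈ downs b) (h : (d : ℕ) < j) :
    plusProd b g d j = plusProd b g (d + 1) j :=
  segProd_succ_of_ne h fun l hl e => by
    simp only [mem_filter, mem_univ, true_and] at hl
    rw [Fin.ext e, downs_false hd] at hl
    exact Bool.noConfusion hl

@[to_additive]
lemma arcProd_arc (hA : A ∈ arcs b) (h : (A.2 : ℕ) < j) :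
    arcProd b f A.1 j = f A * arcProd b f (A.1 + 1) A.2 * arcProd b f (A.2 + 1) j := by
  have h' := arc_lt hA
  rw [arcProd, segProd_succ_of_mem hA rfl (h'.trans h) fun _ hB e => arc_fst_inj hB hA e,
    segProd_split h' h.le, segProd_succ_of_ne h fun _ hB => arc_ends_ne hB hA, mul_assoc]
  rfl

@[to_additive]
lemma upProd_arc (hA : A ∈ arcs b) (h : (A.2 : ℕ) < j) :
    upProd b g A.1 j = upProd b g (A.2 + 1) j := by
  rw [upProd, segProd_split (j := A.2 + 1) (by have := arc_lt hA; omega) h, segProd_eq_one, one_mul,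
    upProd]
  intro u hu
  have := ups_ne_fst hu hA
  have := ups_not_inside hu hA
  omega

@[to_additive]
lemma downProd_arc (hA : A ∈ arcs b) (h : (A.2 : ℕ) < j) :
    downProd b g A.1 j = downProd b g (A.2 + 1) j := by
  rw [downProd, segProd_split (j := A.2 + 1) (by have := arc_lt hA; omega) h, segProd_eq_one,
    one_mul, downProd]
  intro u hu
  have := downs_ne_fst hu hA
  have := downs_not_inside hu hA
  omega

@[to_additive]
lemma plusProd_arc (hA : A ∈ arcs b) (h : (A.2 : ℕ) < j) :
    plusProd b g A.1 j = g A.2 * plusProd b g (A.1 + 1) A.2 * plusProd b g (A.2 + 1) j := by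
  have h' := arc_lt hA
  rw [plusProd, segProd_succ_of_ne (h'.trans h), segProd_split h' h.le,
    segProd_succ_of_mem (a := A.2) (by simp [arc_snd_true hA]) rfl h fun _ _ => Fin.ext,
    mul_left_comm, mul_assoc]
  · rfl
  · intro l hl e
    simp only [mem_filter, mem_univ, true_and] at hl
    rw [Fin.ext e, arc_fst_false hA] at hl
    exact Bool.noConfusion hl

end Peel

section Count

variable {N : ℕ} {b : Fin N → Bool} {i j : ℕ}

/-- Number of arcs with left end in `[i, j)`. -/
def nArc (b : Fin N → Bool) (i j : ℕ) : ℕ := arcSum b (fun _ => 1) i j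

/-- Number of unpaired up arrows in `[i, j)`. -/
def nUp (b : Fin N → Bool) (i j : ℕ) : ℕ := upSum b (fun _ => 1) i j

/-- Number of down arrows in `[i, j)` that belong to no arc. -/
def nDown (b : Fin N → Bool) (i j : ℕ) : ℕ := downSum b (fun _ => 1) i j

@[simp] lemma nArc_self (i : ℕ) : nArc b i i = 0 := arcSum_self i

@[simp] lemma nUp_self (i : ℕ) : nUp b i i = 0 := upSum_self i

@[simp] lemma nDown_self (i : ℕ) : nDown b i i = 0 := downSum_self i

section

variable {u d : Fin N} {A : Fin N × Fin N}

lemma nArc_up (hu : u ∈ ups b) (h : (u : ℕ) < j) : nArc b u j = nArc b (u + 1) j := arcSum_up hu h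

lemma nUp_up (hu : u ∈ ups b) (h : (u : ℕ) < j) : nUp b u j = nUp b (u + 1) j + 1 :=
  (upSum_up hu h).trans (add_comm _ _)

lemma nDown_up (hu : u ∈ ups b) (h : (u : ℕ) < j) : nDown b u j = nDown b (u + 1) j :=
  downSum_up hu h

lemma nArc_down (hd : d ∈ downs b) (h : (d : ℕ) < j) : nArc b d j = nArc b (d + 1) j :=
  arcSum_down hd h

lemma nUp_down (hd : d ∈ downs b) (h : (d : ℕ) < j) : nUp b d j = nUp b (d + 1) j :=
  upSum_down hd h

lemma nDown_down (hd : d ∈ downs b) (h : (d : ℕ) < j) : nDown b d j = nDown b (d + 1) j + 1 :=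
  (downSum_down hd h).trans (add_comm _ _)

lemma nUp_arc (hA : A ∈ arcs b) (h : (A.2 : ℕ) < j) : nUp b A.1 j = nUp b (A.2 + 1) j :=
  upSum_arc hA h

lemma nDown_arc (hA : A ∈ arcs b) (h : (A.2 : ℕ) < j) : nDown b A.1 j = nDown b (A.2 + 1) j :=
  downSum_arc hA h

end

lemma nUp_eq_zero (h : ∀ u ∈ ups b, ¬(i ≤ (u : ℕ) ∧ (u : ℕ) < j)) : nUp b i j = 0 :=
  segSum_eq_zero h

lemma nDown_eq_zero (h : ∀ u ∈ downs b, ¬(i ≤ (u : ℕ) ∧ (u : ℕ) < j)) : nDown b i j = 0 :=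
  segSum_eq_zero h

lemma nUp_inside {A : Fin N × Fin N} (hA : A ∈ arcs b) : nUp b (A.1 + 1) A.2 = 0 :=
  nUp_eq_zero fun u hu => by
    have := ups_not_inside hu hA
    omega

lemma nDown_inside {A : Fin N × Fin N} (hA : A ∈ arcs b) : nDown b (A.1 + 1) A.2 = 0 :=
  nDown_eq_zero fun u hu => by
    have := downs_not_inside hu hA
    omega

lemma Closed.length (h : Closed b i j) : j = i + 2 * nArc b i j + nUp b i j + nDown b i j := by
  refine Closed.induction (P := fun i j => j = i + 2 * nArc b i j + nUp b i j + nDown b i j)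
    ?_ ?_ ?_ ?_ h
  · simp
  · intro u hu j h h' ih
    rw [nArc_up hu h'.le, nUp_up hu h'.le, nDown_up hu h'.le]
    omega
  · intro u hu j h h' ih
    rw [nArc_down hu h'.le, nUp_down hu h'.le, nDown_down hu h'.le]
    omega
  · intro A hA j h h1 h2 ih1 ih2
    rw [nUp_inside hA, nDown_inside hA] at ih1
    have e : nArc b A.1 j = 1 + nArc b (A.1 + 1) A.2 + nArc b (A.2 + 1) j := arcSum_arc hA h2.le
    rw [e, nUp_arc hA h2.le, nDown_arc hA h2.le]
    omega

lemma arc_snd_eq {A : Fin N × Fin N} (hA : A ∈ arcs b) :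
    (A.2 : ℕ) = A.1 + 1 + 2 * nArc b (A.1 + 1) A.2 := by
  have := (Closed.inside hA).length
  rw [nUp_inside hA, nDown_inside hA] at this
  omega

lemma size_eq {A : Fin N × Fin N} (hA : A ∈ arcs b) : size A = nArc b (A.1 + 1) A.2 + 1 := by
  have := arc_snd_eq hA
  have := arc_lt hA
  simp only [size, pos]
  omega

lemma snd_eq {A : Fin N × Fin N} (hA : A ∈ arcs b) : (A.2 : ℕ) + 1 = A.1 + 2 * size A := by
  have := arc_snd_eq hA
  have := size_eq hA
  omega

lemma size_pos {A : Fin N × Fin N} (hA : A ∈ arcs b) : 0 < size A := by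
  rw [size_eq hA]; omega

lemma nArc_arc {A : Fin N × Fin N} (hA : A ∈ arcs b) (h : (A.2 : ℕ) < j) :
    nArc b A.1 j = size A + nArc b (A.2 + 1) j := by
  have e : nArc b A.1 j = 1 + nArc b (A.1 + 1) A.2 + nArc b (A.2 + 1) j := arcSum_arc hA h
  rw [e, size_eq hA, add_comm 1]

lemma plusSum_const (h : Closed b i j) (c : ℤ) :
    plusSum b (fun _ => c) i j = c * (nArc b i j + nUp b i j) := by
  refine Closed.induction
    (P := fun i j => plusSum b (fun _ => c) i j = c * (nArc b i j + nUp b i j)) ?_ ?_ ?_ ?_ h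
  · intro i _
    simp [plusSum_self]
  · intro u hu j h h' ih
    rw [nArc_up hu h'.le, nUp_up hu h'.le, plusSum_up hu h'.le, ih]
    push_cast; ring
  · intro u hu j h h' ih
    rw [nArc_down hu h'.le, nUp_down hu h'.le, plusSum_down hu h'.le, ih]
  · intro A hA j h h1 h2 ih1 ih2
    rw [nArc_arc hA h2.le, nUp_arc hA h2.le, plusSum_arc hA h2.le, ih1, ih2, nUp_inside hA,
      size_eq hA]
    push_cast; ring

lemma plusSum_sub (h : Closed b i j) (c c' : ℤ) :
    plusSum b (fun l => c - (l : ℕ)) i j =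
      plusSum b (fun l => c' - (l : ℕ)) i j + (c - c') * (nArc b i j + nUp b i j) := by
  rw [← plusSum_const h, plusSum, plusSum, plusSum, segSum, segSum, segSum, ← sum_add_distrib]
  exact sum_congr rfl fun l _ => by ring

end Count

/-! ### The hook length formula -/

section Hook

variable {N : ℕ} {b : Fin N → Bool} {i j : ℕ}

local notation "𝐪" => (RatFunc.X : RatFunc ℂ)

/-- The product of the inverse hook lengths of the arcs in `[i, j)` and of the unpaired up arrows
in `[i, j)`, when the latter are numbered together with the arcs from left to right, starting with
`n + 1`. -/
noncomputable def hooks (b : Fin N → Bool) (n i j : ℕ) : RatFunc ℂ :=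
  arcProd b (fun A => (qInt 𝐪 (size A))⁻¹) i j *
    upProd b (fun u => (qInt 𝐪 (n + (nArc b i (u + 1) + nUp b i (u + 1))))⁻¹) i j

lemma hooks_self (n i : ℕ) : hooks b n i i = 1 := by
  simp [hooks, arcProd_self, upProd_self]

lemma hooks_up {u : Fin N} (hu : u ∈ ups b) (h : (u : ℕ) < j) (n : ℕ) :
    hooks b n u j = (qInt 𝐪 (n + 1))⁻¹ * hooks b (n + 1) (u + 1) j := by
  rw [hooks, hooks, arcProd_up hu h, upProd_up hu h, mul_left_comm]
  congr 2
  · rw [nArc_up hu (Nat.lt_succ_self _), nUp_up hu (Nat.lt_succ_self _), nArc_self, nUp_self]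
  · refine segProd_congr fun v hv hv1 hv2 => ?_
    rw [nArc_up hu (by omega), nUp_up hu (by omega)]
    congr 2; ring

lemma hooks_arc {A : Fin N × Fin N} (hA : A ∈ arcs b) (h : (A.2 : ℕ) < j) (n : ℕ) :
    hooks b n A.1 j = (qInt 𝐪 (size A))⁻¹ * hooks b 0 (A.1 + 1) A.2 *
      hooks b (n + size A) (A.2 + 1) j := by
  have h0 : upProd b (fun u => (qInt 𝐪 (0 + (nArc b (A.1 + 1) (u + 1) +
      nUp b (A.1 + 1) (u + 1))))⁻¹) (A.1 + 1) A.2 = 1 :=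
    segProd_eq_one fun u hu => by
      have := ups_not_inside hu hA
      omega
  rw [hooks, hooks, hooks, arcProd_arc hA h, upProd_arc hA h, h0, mul_one, ← mul_assoc]
  congr 1
  refine segProd_congr fun v hv hv1 hv2 => ?_
  rw [nArc_arc hA (by omega), nUp_arc hA (by omega)]
  congr 2; ring

theorem good_hooks (h : Closed b i j) (hd : nDown b i j = 0) (n : ℕ) :
    Good (qRise 𝐪 n (nArc b i j + nUp b i j) * hooks b n i j)
      (plusSum b (fun l => (j : ℤ) - (l : ℕ)) i j + n * nArc b i j -
        ∑ t ∈ range (nArc b i j + nUp b i j), ((t : ℤ) + 1)) := by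
  refine Closed.induction (P := fun i j => nDown b i j = 0 → ∀ n : ℕ,
    Good (qRise 𝐪 n (nArc b i j + nUp b i j) * hooks b n i j)
      (plusSum b (fun l => (j : ℤ) - (l : ℕ)) i j + n * nArc b i j -
        ∑ t ∈ range (nArc b i j + nUp b i j), ((t : ℤ) + 1))) ?_ ?_ ?_ ?_ h hd n
  · intro i _ _ n
    simpa [nArc, nUp, arcSum_self, upSum_self, plusSum_self, hooks_self] using Good.one
  · intro u hu j h h' ih hd n
    rw [nDown_up hu h'.le] at hd
    have hl := h'.length
    rw [hd] at hl
    refine (ih hd (n + 1)).congr ?_ ?_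
    · have := qInt_ne_zero (show 0 < n + 1 by omega)
      rw [nArc_up hu h'.le, nUp_up hu h'.le, ← add_assoc, qRise_succ', hooks_up hu h'.le]
      field_simp
    · rw [nArc_up hu h'.le, nUp_up hu h'.le, ← add_assoc, sum_range_succ, plusSum_up hu h'.le]
      have : (j : ℤ) = u + 1 + 2 * nArc b (u + 1) j + nUp b (u + 1) j + 0 := by exact_mod_cast hl
      push_cast
      linear_combination -this
  · intro d hd' j h h' ih hd
    rw [nDown_down hd' h'.le] at hd
    omega
  · intro A hA j h h1 h2 ih1 ih2 hd n
    rw [nDown_arc hA h2.le] at hd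
    have hl := h2.length
    rw [hd] at hl
    have hs := size_eq hA
    have hi := ih1 (nDown_inside hA) 0
    rw [nUp_inside hA, add_zero, qRise_zero_left] at hi
    have hsub := plusSum_sub h1 j (A.2 : ℕ)
    rw [nUp_inside hA] at hsub
    refine (((Good.qBin n (size A)).mul hi).mul (ih2 hd (n + size A))).congr ?_ ?_
    · have := qInt_ne_zero (size_pos hA)
      have h3 := qFact_ne_zero (nArc b (A.1 + 1) A.2)
      rw [nArc_arc hA h2.le, nUp_arc hA h2.le, hooks_arc hA h2.le, add_assoc,
        qRise_add n (size A), qBin]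
      rw [hs] at this ⊢
      rw [qFact_succ]
      field_simp
    · have : (j : ℤ) = A.2 + 1 + 2 * nArc b (A.2 + 1) j + nUp b (A.2 + 1) j + 0 := by
        exact_mod_cast hl
      rw [nArc_arc hA h2.le, nUp_arc hA h2.le, plusSum_arc hA h2.le, add_assoc (size A), hsub, hs,
        sum_range_add _ (nArc b (A.1 + 1) A.2 + 1), sum_range_succ]
      simp only [Nat.cast_add, add_assoc, sum_add_distrib, sum_const, card_range, nsmul_eq_mul]
      push_cast
      rw [this]
      ring

end Hook

/-! ### Telescoping products over outer arcs -/

section Telescope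

variable {N : ℕ} {b : Fin N → Bool} {i j : ℕ} {K : Type*} [Field K]

/-- The arc `A` lies inside no other arc. -/
def IsOuter (b : Fin N → Bool) (A : Fin N × Fin N) : Prop :=
  ∀ B ∈ arcs b, ¬(B.1 < A.1 ∧ A.2 < B.2)

open Classical in
theorem arcProd_telescope (F : ℕ → K) (hF : ∀ l, i ≤ l → l ≤ j → F l ≠ 0) (h : Closed b i j)
    (hu : nUp b i j = 0) (hd : nDown b i j = 0)
    (ho : ∀ B ∈ arcs b, ¬((B.1 : ℕ) < i ∧ j ≤ B.2)) :
    arcProd b (fun A => if IsOuter b A then F A.1 / F (A.2 + 1) else 1) i j = F i / F j := by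
  refine Closed.induction (P := fun i j => (∀ l, i ≤ l → l ≤ j → F l ≠ 0) → nUp b i j = 0 →
    nDown b i j = 0 → (∀ B ∈ arcs b, ¬((B.1 : ℕ) < i ∧ j ≤ B.2)) →
    arcProd b (fun A => if IsOuter b A then F A.1 / F (A.2 + 1) else 1) i j = F i / F j)
    ?_ ?_ ?_ ?_ h hF hu hd ho
  · intro i _ hF _ _ _
    rw [arcProd_self, div_self (hF i le_rfl le_rfl)]
  · intro u hu' j h h' ih _ hu
    rw [nUp_up hu' h'.le] at hu
    omega
  · intro d hd' j h h' ih _ _ hd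
    rw [nDown_down hd' h'.le] at hd
    omega
  · intro A hA j h h1 h2 ih1 ih2 hF hu hd ho
    have hlt := arc_lt hA
    have h2le := h2.le
    have hin : arcProd b (fun A => if IsOuter b A then F A.1 / F (A.2 + 1) else 1)
        (A.1 + 1) A.2 = 1 := by
      refine prod_eq_one fun B hB => if_neg fun hB' => ?_
      obtain ⟨hB1, hB2, hB3⟩ : B ∈ arcs b ∧ (A.1 : ℕ) + 1 ≤ B.1 ∧ (B.1 : ℕ) < A.2 := by
        simpa using hB
      exact hB' A hA ⟨Fin.lt_def.2 hB2, Fin.lt_def.2 (arc_nested hA hB1 hB2 hB3.le)⟩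
    have hA' : IsOuter b A := fun B hB hBA => by
      have e1 := h.iff B hB
      have e2 := ho B hB
      simp only [Fin.lt_def] at hBA
      omega
    have ho' : ∀ B ∈ arcs b, ¬((B.1 : ℕ) < A.2 + 1 ∧ j ≤ B.2) := by
      intro B hB hB'
      have e1 := h.iff B hB
      have e2 := ho B hB
      have e3 := arc_lt hB
      omega
    rw [arcProd_arc hA h2.le, hin, if_pos hA', ih2 (fun l hl hl' => hF l (by omega) hl')
      (by rwa [nUp_arc hA h2.le] at hu) (by rwa [nDown_arc hA h2.le] at hd) ho', mul_one,
      div_mul_div_cancel₀ (hF _ (by omega) (by omega))]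

end Telescope

end TypeBI
namespace TypeBI

open Finset

section Level

variable {N : ℕ} {b : Fin N → Bool} {i j k : ℕ}

local notation "𝐪" => (RatFunc.X : RatFunc ℂ)

lemma lt_of_nUp_eq_zero (h : nUp b i N = 0) {u : Fin N} (hu : u ∈ ups b) : (u : ℕ) < i := by
  by_contra! H
  have : u ∈ (ups b).filter fun a : Fin N => i ≤ (a : ℕ) ∧ (a : ℕ) < N := by simp [hu, H]
  have := card_pos.2 ⟨u, this⟩
  rw [nUp, upSum, segSum, ← card_eq_sum_ones] at h
  omega

section

variable {M' : Type*} [CommMonoid M'] {f : Fin N × Fin N → M'} {g : Fin N → M'}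

@[to_additive]
lemma arcProd_mul (h : i ≤ j) (h' : j ≤ k) :
    arcProd b f i k = arcProd b f i j * arcProd b f j k := segProd_split h h'

@[to_additive]
lemma upProd_mul (h : i ≤ j) (h' : j ≤ k) :
    upProd b g i k = upProd b g i j * upProd b g j k := segProd_split h h'

@[to_additive]
lemma downProd_mul (h : i ≤ j) (h' : j ≤ k) :
    downProd b g i k = downProd b g i j * downProd b g j k := segProd_split h h'

@[to_additive]
lemma plusProd_mul (h : i ≤ j) (h' : j ≤ k) :
    plusProd b g i k = plusProd b g i j * plusProd b g j k := segProd_split h h'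

end

lemma nArc_add (h : i ≤ j) (h' : j ≤ k) : nArc b i k = nArc b i j + nArc b j k :=
  arcSum_add h h'

lemma nUp_add (h : i ≤ j) (h' : j ≤ k) : nUp b i k = nUp b i j + nUp b j k :=
  upSum_add h h'

lemma nDown_add (h : i ≤ j) (h' : j ≤ k) : nDown b i k = nDown b i j + nDown b j k :=
  downSum_add h h'

lemma nDown_eq_card (b : Fin N → Bool) (i : ℕ) :
    nDown b i N = ((downs b).filter fun d : Fin N => i ≤ (d : ℕ)).card := by
  rw [nDown, downSum, segSum, ← card_eq_sum_ones]
  congr 1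
  exact filter_congr fun d _ => by simp

lemma rank_eq (b : Fin N → Bool) (d : Fin N) : rank b d = nDown b d N := by
  rw [nDown_eq_card]; rfl

/-- Number of items without unpaired up arrows, apart from arcs, in the diagram of a string with
`r` down arrows outside of arcs. -/
def downItems (M r : ℕ) : ℕ := min r M + (r - M) / 2

/-- `downItems M r` without the items with an integer `p ≥ 2`. -/
def dashItems (M r : ℕ) : ℕ := (r + 2 - M) / 2

/-- The number of the down arrow `d` in the enumeration of the items from right to left. -/
def downNum (M : ℕ) (b : Fin N → Bool) (d : Fin N) : ℕ := nArc b d N + downItems M (rank b d)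

/-- The contribution of a down arrow outside of the arcs. -/
noncomputable def downWeight (M : ℕ) (b : Fin N → Bool) (d : Fin N) : RatFunc ℂ :=
  if rank b d < M then (qInt 𝐪 (downNum M b d))⁻¹
  else if Even (rank b d - M) then (qInt 𝐪 (2 * downNum M b d))⁻¹ else 1

/-- An outer arc `A` carrying a nontrivial factor in `N9`. -/
def IsCorr (M : ℕ) (b : Fin N → Bool) (A : Fin N × Fin N) : Prop :=
  IsOuter b A ∧ (∀ u ∈ ups b, u < A.1) ∧ M ≤ nDown b A.1 N ∧ Even (nDown b A.1 N - M)

open Classical in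
/-- The factor of the arc `A` in `N9`. -/
noncomputable def corrWeight (M : ℕ) (b : Fin N → Bool) (A : Fin N × Fin N) : RatFunc ℂ :=
  if IsCorr M b A then
    qInt 𝐪 (d3 A + size A + M) / qInt 𝐪 (d3 A + 2 * size A + M) else 1

/-- The value of `psi` for the string of the letters at the positions `i, …, N`. -/
noncomputable def phi (M : ℕ) (b : Fin N → Bool) (i : ℕ) : RatFunc ℂ :=
  arcProd b (fun A => (qInt 𝐪 (size A))⁻¹) i N * arcProd b (corrWeight M b) i N *
    downProd b (downWeight M b) i N *
    (qFact 𝐪 (nArc b i N + downItems M (nDown b i N)) *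
      symRise 𝐪 (M - 1) (nArc b i N + dashItems M (nDown b i N)))

/-- The factor of a block of `m` letters `+` placed to the left of `s` arcs and `r` down arrows. -/
noncomputable def blockWeight (M s r m : ℕ) : RatFunc ℂ :=
  qRise 𝐪 (s + downItems M r) m * symRise 𝐪 (M - 1 + (s + dashItems M r)) m *
    if M ≤ r ∧ Even (r - M) then
      qInt 𝐪 (2 * (s + downItems M r) + m) / qInt 𝐪 (2 * (s + downItems M r) + 2 * m)
    else 1

variable {M : ℕ}

lemma good_blockWeight (hM : 1 ≤ M) (s r m : ℕ) :
    Good (blockWeight M s r m / qFact 𝐪 m)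
      ((2 * s + r + M - 1) * m + ∑ t ∈ range m, ((t : ℤ) + 1)) := by
  have hr : blockWeight M s r m / qFact 𝐪 m =
      qBin 𝐪 (s + downItems M r) m * symRise 𝐪 (M - 1 + (s + dashItems M r)) m *
      if M ≤ r ∧ Even (r - M) then
        qInt 𝐪 (2 * (s + downItems M r) + m) / qInt 𝐪 (2 * (s + downItems M r) + 2 * m)
      else 1 := by
    rw [blockWeight, qBin]; ring
  rw [hr]
  have hsum : ∀ x : ℤ, ∑ t ∈ range m, (x + t + 1) = m * x + ∑ t ∈ range m, ((t : ℤ) + 1) := by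
    intro x
    simp only [add_assoc]
    rw [sum_add_distrib]
    simp
  split_ifs with h
  · obtain ⟨h1, h2⟩ := h
    have e : M - 1 + (s + dashItems M r) = s + downItems M r := by
      obtain ⟨c, hc⟩ := h2
      simp only [dashItems, downItems]; omega
    rw [e]
    refine (Good.qBin_mul_div (by simp only [downItems]; omega) m).congr rfl ?_
    have e' : (2 * downItems M r : ℤ) = r + M := by
      obtain ⟨c, hc⟩ := h2
      simp only [downItems]; omega
    rw [hsum]; push_cast
    linear_combination (m : ℤ) * e'
  · rw [mul_one]
    refine ((Good.qBin _ _).mul (Good.symRise _ _)).congr rfl ?_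
    have e' : (downItems M r + dashItems M r : ℤ) = r := by
      rw [Nat.even_iff] at h
      simp only [downItems, dashItems]; omega
    rw [hsum]; push_cast [hM]
    linear_combination (m : ℤ) * e'

theorem good_block (hM : 1 ≤ M) (h : Closed b i k) (hk : Closed b k N) (hu : nUp b k N = 0)
    (hd : nDown b i k = 0) :
    Good (blockWeight M (nArc b k N) (nDown b k N) (nArc b i k + nUp b i k) * hooks b 0 i k)
      (plusSum b (fun l => (N : ℤ) + M - 1 - (l : ℕ)) i k) := by
  have h1 := good_blockWeight hM (nArc b k N) (nDown b k N) (nArc b i k + nUp b i k)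
  have h2 := good_hooks h hd 0
  rw [qRise_zero_left] at h2
  have hl := hk.length
  have hl' : (N : ℤ) = k + 2 * nArc b k N + nDown b k N := by
    rw [hu] at hl; omega
  refine (h1.mul h2).congr ?_ ?_
  · have := qFact_ne_zero (nArc b i k + nUp b i k)
    field_simp
  · rw [plusSum_sub h ((N : ℤ) + M - 1) (k : ℤ)]
    push_cast
    linear_combination -((nArc b i k : ℤ) + nUp b i k) * hl'

open Classical in
theorem good_phi (hM : 1 ≤ M) (h : Closed b i N) (hu : nUp b i N = 0) :
    Good (phi M b i) (plusSum b (fun l => (N : ℤ) + M - 1 - (l : ℕ)) i N) := by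
  refine Closed.induction (P := fun i j => j = N → nUp b i j = 0 →
    Good (phi M b i) (plusSum b (fun l => (N : ℤ) + M - 1 - (l : ℕ)) i N)) ?_ ?_ ?_ ?_ h rfl hu
  · rintro i _ rfl _
    have e1 : downItems M 0 = 0 := by simp [downItems]
    have e2 : dashItems M 0 = 0 := by simp only [dashItems]; omega
    simpa [phi, arcProd_self, downProd_self, plusSum_self, e1, e2] using Good.one
  · rintro u hu j h h' ih rfl hu'
    rw [nUp_up hu u.2] at hu'
    omega
  · rintro d hd j h h' ih rfl hu'
    rw [nUp_down hd d.2] at hu'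
    refine (ih rfl hu').congr ?_ (plusSum_down hd d.2).symm
    rw [phi, phi, arcProd_down hd d.2, arcProd_down hd d.2, downProd_down hd d.2,
      nArc_down hd d.2, nDown_down hd d.2]
    set s := nArc b (d + 1) j
    set r := nDown b (d + 1) j
    have hr : rank b d = r + 1 := by rw [rank_eq, nDown_down hd d.2]
    have hn : downNum M b d = s + downItems M (r + 1) := by
      rw [downNum, hr, nArc_down hd d.2]
    have hw : qFact 𝐪 (s + downItems M r) * symRise 𝐪 (M - 1) (s + dashItems M r) =
        downWeight M b d * (qFact 𝐪 (s + downItems M (r + 1)) *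
          symRise 𝐪 (M - 1) (s + dashItems M (r + 1))) := by
      rw [downWeight, hr, hn]
      split_ifs with h1 h2
      · have e1 : downItems M (r + 1) = downItems M r + 1 := by simp only [downItems]; omega
        have e2 : dashItems M (r + 1) = dashItems M r := by simp only [dashItems]; omega
        rw [e1, e2, ← add_assoc, qFact_succ]
        have := qInt_ne_zero (show 0 < s + downItems M r + 1 by omega)
        field_simp
      · obtain ⟨c, hc⟩ := h2
        have e1 : downItems M (r + 1) = downItems M r + 1 := by simp only [downItems]; omega
        have e2 : dashItems M (r + 1) = dashItems M r + 1 := by simp only [dashItems]; omega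
        have e3 : M - 1 + (s + dashItems M r) = s + downItems M r := by
          simp only [dashItems, downItems]; omega
        rw [e1, e2, ← add_assoc, ← add_assoc, qFact_succ, symRise_succ, e3,
          qInt_two_mul RatFunc.X_ne_zero]
        have := qInt_ne_zero (show 0 < s + downItems M r + 1 by omega)
        have := qSym_ne_zero (show 0 < s + downItems M r + 1 by omega)
        field_simp
      · rw [Nat.even_iff] at h2
        have e1 : downItems M (r + 1) = downItems M r := by simp only [downItems]; omega
        have e2 : dashItems M (r + 1) = dashItems M r := by simp only [dashItems]; omega
        rw [e1, e2, one_mul]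
    rw [hw]
    ring
  · rintro A hA j h h1 h2 _ ih rfl hu'
    have hu2 := hu'
    rw [nUp_arc hA h2.le] at hu2
    have hA1 := arc_lt hA
    have h3 : Closed b A.1 (A.2 + 1) := h.diff (by omega) h2.le h2
    have hd3 : nDown b A.1 (A.2 + 1) = 0 := by
      rw [nDown_arc hA (Nat.lt_succ_self _), nDown_self]
    have hu3 : nUp b A.1 (A.2 + 1) = 0 := by
      rw [nUp_arc hA (Nat.lt_succ_self _), nUp_self]
    have ha3 : nArc b A.1 (A.2 + 1) = size A := by
      rw [nArc_arc hA (Nat.lt_succ_self _), nArc_self, add_zero]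
    have hr : nDown b A.1 j = nDown b (A.2 + 1) j := nDown_arc hA h2.le
    refine ((good_block hM h3 h2 hu2 hd3).mul (ih rfl hu2)).congr ?_
      (plusSum_add h3.le h2.le).symm
    have hcorr : arcProd b (corrWeight M b) A.1 (A.2 + 1) = corrWeight M b A := by
      rw [arcProd_arc hA (Nat.lt_succ_self _), arcProd_self, mul_one]
      have : arcProd b (corrWeight M b) (A.1 + 1) A.2 = 1 := by
        refine prod_eq_one fun B hB => if_neg fun hB' => ?_
        obtain ⟨hB1, hB2, hB3⟩ : B ∈ arcs b ∧ (A.1 : ℕ) + 1 ≤ B.1 ∧ (B.1 : ℕ) < A.2 := by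
          simpa using hB
        exact hB'.1 A hA ⟨Fin.lt_def.2 hB2, Fin.lt_def.2 (arc_nested hA hB1 hB2 hB3.le)⟩
      rw [this, mul_one]
    have hiff : IsCorr M b A ↔ M ≤ nDown b (A.2 + 1) j ∧ Even (nDown b (A.2 + 1) j - M) := by
      rw [IsCorr, hr]
      refine ⟨fun H => H.2.2, fun H => ⟨fun B hB hBA => ?_, fun u hu =>
        Fin.lt_def.2 (lt_of_nUp_eq_zero hu' hu), H⟩⟩
      have := h.iff B hB
      simp only [Fin.lt_def] at hBA
      omega
    have hl := h2.length
    rw [hu2] at hl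
    have hcw : corrWeight M b A =
        if M ≤ nDown b (A.2 + 1) j ∧ Even (nDown b (A.2 + 1) j - M) then
          qInt 𝐪 (2 * (nArc b (A.2 + 1) j + downItems M (nDown b (A.2 + 1) j)) + size A) /
          qInt 𝐪 (2 * (nArc b (A.2 + 1) j + downItems M (nDown b (A.2 + 1) j)) + 2 * size A)
        else 1 := by
      rw [corrWeight, if_congr hiff rfl rfl]
      refine if_ctx_congr Iff.rfl (fun H => ?_) fun _ => rfl
      obtain ⟨H1, c, hc⟩ := H
      have : d3 A + M = 2 * (nArc b (A.2 + 1) j + downItems M (nDown b (A.2 + 1) j)) := by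
        simp only [d3, pos, downItems]; omega
      rw [← this]
      congr 2 <;> ring
    have hh : hooks b 0 A.1 (A.2 + 1) =
        arcProd b (fun A => (qInt 𝐪 (size A))⁻¹) A.1 (A.2 + 1) := by
      rw [hooks, upProd_arc hA (Nat.lt_succ_self _), upProd_self, mul_one]
    rw [phi, phi, arcProd_mul h3.le h2.le,
      arcProd_mul h3.le h2.le, hcorr, hcw, hh,
      downProd_arc hA h2.le, nArc_arc hA h2.le, hr, hu3, ha3, add_zero, blockWeight,
      add_comm (size A) (nArc b (A.2 + 1) j), add_right_comm _ (size A),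
      add_right_comm _ (size A), ← qFact_mul_qRise _ (size A), symRise_add _ _ (size A)]
    ring

end Level

end TypeBI
namespace TypeBI

open Finset

/-! ### Products over the elements of a finite set numbered in order -/

section Enum

variable {α R : Type*} [LinearOrder α] [CommMonoid R]

@[to_additive]
lemma prod_card_ge (s : Finset α) (f : ℕ → R) :
    ∏ a ∈ s, f (s.filter fun k => a ≤ k).card = ∏ i ∈ range s.card, f (i + 1) := by
  induction s using Finset.induction_on_min with
  | empty => simp
  | insert a s ha ih =>
    have has : a ∉ s := fun h => lt_irrefl _ (ha a h)
    rw [prod_insert has, card_insert_of_notMem has, prod_range_succ, ← ih, mul_comm]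
    congr 1
    · refine prod_congr rfl fun c hc => ?_
      rw [filter_insert, if_neg (ha c hc).not_ge]
    · rw [filter_true_of_mem, card_insert_of_notMem has]
      intro c hc
      rcases mem_insert.1 hc with rfl | hc
      · rfl
      · exact (ha c hc).le

@[to_additive]
lemma prod_card_le (s : Finset α) (f : ℕ → R) :
    ∏ a ∈ s, f (s.filter fun k => k ≤ a).card = ∏ i ∈ range s.card, f (i + 1) := by
  induction s using Finset.induction_on_max with
  | empty => simp
  | insert a s ha ih =>
    have has : a ∉ s := fun h => lt_irrefl _ (ha a h)
    rw [prod_insert has, card_insert_of_notMem has, prod_range_succ, ← ih, mul_comm]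
    congr 1
    · refine prod_congr rfl fun c hc => ?_
      rw [filter_insert, if_neg (ha c hc).not_ge]
    · rw [filter_true_of_mem, card_insert_of_notMem has]
      intro c hc
      rcases mem_insert.1 hc with rfl | hc
      · rfl
      · exact (ha c hc).le

end Enum

/-! ### The down arrows outside of the arcs, sorted by rank -/

section Rank

variable {N M : ℕ} {b : Fin N → Bool} {i j : ℕ} {d e : Fin N}

lemma rank_pos (hd : d ∈ downs b) : 0 < rank b d :=
  card_pos.2 ⟨d, by simp [hd]⟩

lemma rank_eq_succ (hd : d ∈ downs b) : rank b d = nDown b (d + 1) N + 1 := by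
  rw [rank_eq, nDown_down hd d.2]

lemma nDown_anti (h : i ≤ j) (hj : j ≤ N) : nDown b j N ≤ nDown b i N := by
  rw [nDown_add h hj]; omega

lemma rank_le_nDown (hd : d ∈ downs b) (hi : i ≤ N) : rank b d ≤ nDown b i N ↔ i ≤ d := by
  constructor
  · intro h
    by_contra! H
    rw [rank_eq_succ hd] at h
    have := nDown_anti (b := b) (show (d : ℕ) + 1 ≤ i from H) hi
    omega
  · intro h
    rw [rank_eq]
    exact nDown_anti h d.2.le

lemma rank_le_rank (hd : d ∈ downs b) : rank b d ≤ rank b e ↔ (e : ℕ) ≤ d := by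
  rw [rank_eq b e, rank_le_nDown hd e.2.le]

lemma rank_inj (hd : d ∈ downs b) (he : e ∈ downs b) (h : rank b d = rank b e) : d = e :=
  Fin.ext (le_antisymm ((rank_le_rank he).1 h.ge) ((rank_le_rank hd).1 h.le))

lemma rank_lt_rank (he : e ∈ downs b) : rank b d < rank b e ↔ (e : ℕ) < d := by
  rw [← not_le, rank_le_rank he, not_le]

@[to_additive]
lemma prod_rank {R : Type*} [CommMonoid R] (f : ℕ → R) (i : ℕ) :
    ∏ d ∈ (downs b).filter (fun d : Fin N => i ≤ (d : ℕ)), f (rank b d) = ∏ t ∈ range (nDown b i N), f (t + 1) := by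
  rw [nDown_eq_card, ← prod_card_ge]
  refine prod_congr rfl fun d hd => ?_
  rw [rank, filter_filter]
  congr 2
  refine filter_congr fun k _ => ?_
  rw [mem_filter] at hd
  simp only [Fin.le_def]
  omega

lemma card_rank (p : ℕ → Prop) [DecidablePred p] (i : ℕ) :
    ((downs b).filter fun d => p (rank b d) ∧ i ≤ d.val).card =
      ((range (nDown b i N)).filter fun t => p (t + 1)).card := by
  have := sum_rank (b := b) (fun t => if p t then 1 else 0) i
  simp only [card_filter]
  rw [← this, sum_filter]
  refine sum_congr rfl fun d _ => ?_
  by_cases h1 : p (rank b d) <;> by_cases h2 : i ≤ d.val <;> simp [h1, h2]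

lemma exists_rank {k : ℕ} (hk : 1 ≤ k) (hk' : k ≤ nDown b 0 N) : ∃ d ∈ downs b, rank b d = k := by
  have := card_rank (b := b) (fun t => t = k) 0
  have h : 0 < ((range (nDown b 0 N)).filter fun t => t + 1 = k).card :=
    card_pos.2 ⟨k - 1, by simp; omega⟩
  rw [← this] at h
  obtain ⟨d, hd⟩ := card_pos.1 h
  simp only [mem_filter] at hd
  exact ⟨d, hd.1, hd.2.1⟩

lemma rank_le (b : Fin N → Bool) (d : Fin N) : rank b d ≤ nDown b 0 N := by
  rw [rank_eq]; exact nDown_anti (Nat.zero_le _) d.2.le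

lemma setU_eq (M : ℕ) (b : Fin N → Bool) :
    setU M b = (downs b).filter fun d => rank b d < M :=
  filter_congr fun d hd => by
    have := rank_pos hd
    simp only [label]; omega

lemma setU'_eq (M : ℕ) (b : Fin N → Bool) :
    setU' M b = (downs b).filter fun d => 2 ≤ rank b d ∧ rank b d < M :=
  filter_congr fun d hd => by
    have := rank_pos hd
    simp only [label]; omega

lemma star_eq (M : ℕ) (b : Fin N → Bool) :
    star M b = (downs b).filter fun d => rank b d = M :=
  filter_congr fun d hd => by
    simp only [label]; omega

lemma marked_self (hM : 1 ≤ M) (b : Fin N → Bool) :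
    marked M b M = (downs b).filter fun d => rank b d = 1 :=
  filter_congr fun d hd => by
    have := rank_pos hd
    simp only [label]; omega

lemma mem_star : d ∈ star M b ↔ d ∈ downs b ∧ rank b d = M := by
  rw [star_eq, mem_filter]

lemma mem_marked_self (hM : 1 ≤ M) : d ∈ marked M b M ↔ d ∈ downs b ∧ rank b d = 1 := by
  rw [marked_self hM, mem_filter]

lemma mem_dashed {E : Fin N × Fin N} : E ∈ dashed M b ↔ E.1 ∈ downs b ∧ E.2 ∈ downs b ∧
    M < rank b E.2 ∧ Odd (rank b E.2 - M) ∧ rank b E.1 = rank b E.2 + 1 := by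
  simp [dashed, and_assoc]

lemma image_dashed (M : ℕ) (b : Fin N → Bool) :
    (dashed M b).image Prod.fst =
      (downs b).filter fun d => M < rank b d ∧ Even (rank b d - M) := by
  ext d
  simp only [mem_image, mem_filter, mem_dashed, Nat.even_iff, Nat.odd_iff]
  constructor
  · rintro ⟨E, ⟨h1, h2, h3, h4, h5⟩, rfl⟩
    exact ⟨h1, by omega, by omega⟩
  · rintro ⟨h1, h2, h3⟩
    obtain ⟨e, he, he'⟩ := exists_rank (b := b) (k := rank b d - 1) (by omega)
      (by have := rank_le b d; omega)
    exact ⟨(d, e), ⟨h1, he, by simp only; omega, by simp only; omega, by simp only; omega⟩, rfl⟩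

lemma dashed_fst_inj : Set.InjOn Prod.fst (dashed M b : Set (Fin N × Fin N)) := by
  intro E hE F hF h
  rw [mem_coe, mem_dashed] at hE hF
  refine Prod.ext h (rank_inj hE.2.1 hF.2.1 ?_)
  rw [h] at hE
  omega

@[to_additive]
lemma prod_dashed {R : Type*} [CommMonoid R] (f : Fin N → R) :
    ∏ E ∈ dashed M b, f E.1 =
      ∏ d ∈ downs b with M < rank b d ∧ Even (rank b d - M), f d := by
  rw [← image_dashed, prod_image dashed_fst_inj]

lemma unpaired_eq (M : ℕ) (b : Fin N → Bool) : unpaired M b =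
    (downs b).filter fun d => M < rank b d ∧ rank b d = nDown b 0 N ∧ ¬Even (rank b d - M) := by
  refine filter_congr fun d hd => and_congr_right fun hM => ?_
  constructor
  · intro h
    have h1 : ¬Even (rank b d - M) := fun he => by
      have : d ∈ (dashed M b).image Prod.fst := by
        rw [image_dashed, mem_filter]; exact ⟨hd, hM, he⟩
      obtain ⟨E, hE, hE'⟩ := mem_image.1 this
      exact (h E hE).1 hE'
    refine ⟨?_, h1⟩
    by_contra H
    obtain ⟨e, he, he'⟩ := exists_rank (b := b) (k := rank b d + 1) (by omega)
      (by have := rank_le b d; omega)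
    refine (h (e, d) (mem_dashed.2 ⟨he, hd, hM, ?_, he'⟩)).2 rfl
    rwa [Nat.not_even_iff_odd] at h1
  · rintro ⟨h1, h2⟩ E hE
    obtain ⟨e1, e2, e3, e4, e5⟩ := mem_dashed.1 hE
    rw [Nat.not_even_iff_odd] at h2
    refine ⟨fun e => ?_, fun e => ?_⟩
    · rw [e] at e5
      rw [Nat.odd_iff] at e4 h2
      omega
    · have := rank_le b E.1
      rw [e] at e5; omega

lemma mem_unpaired : d ∈ unpaired M b ↔
    d ∈ downs b ∧ M < rank b d ∧ rank b d = nDown b 0 N ∧ ¬Even (rank b d - M) := by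
  rw [unpaired_eq, mem_filter]

lemma card_range_lt (r M : ℕ) : ((range r).filter fun t => t + 1 < M).card = min r (M - 1) := by
  induction r with
  | zero => simp
  | succ r ih =>
    rw [range_add_one, filter_insert]
    split_ifs
    · rw [card_insert_of_notMem (by simp), ih]; omega
    · rw [ih]; omega

lemma card_range_eq (r : ℕ) {M : ℕ} (hM : 1 ≤ M) :
    ((range r).filter fun t => t + 1 = M).card = if M ≤ r then 1 else 0 := by
  induction r with
  | zero => simp; omega
  | succ r ih =>
    rw [range_add_one, filter_insert]
    split_ifs
    · rw [card_insert_of_notMem (by simp), ih, if_neg (by omega)]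
    · omega
    · rw [ih, if_pos (by omega)]
    · rw [ih, if_neg (by omega)]

lemma card_range_even (r M : ℕ) :
    ((range r).filter fun t => M < t + 1 ∧ Even (t + 1 - M)).card = (r - M) / 2 := by
  induction r with
  | zero => simp
  | succ r ih =>
    rw [range_add_one, filter_insert]
    simp only [Nat.even_iff] at ih ⊢
    split_ifs
    · rw [card_insert_of_notMem (by simp), ih]; omega
    · rw [ih]; omega

lemma card_range_items (r M : ℕ) :
    ((range r).filter fun t => t + 1 ≤ M ∨ Even (t + 1 - M)).card = downItems M r := by
  induction r with
  | zero => simp [downItems]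
  | succ r ih =>
    rw [range_add_one, filter_insert]
    simp only [Nat.even_iff, downItems] at ih ⊢
    split_ifs
    · rw [card_insert_of_notMem (by simp), ih]; omega
    · rw [ih]; omega

lemma card_rank' (p : ℕ → Prop) [DecidablePred p] :
    ((downs b).filter fun d => p (rank b d)).card =
      ((range (nDown b 0 N)).filter fun t => p (t + 1)).card := by
  rw [← card_rank p 0]
  simp

lemma card_setU (M : ℕ) (b : Fin N → Bool) : (setU M b).card = min (nDown b 0 N) (M - 1) := by
  rw [setU_eq, card_rank' (· < M), card_range_lt]

lemma card_star (hM : 1 ≤ M) (b : Fin N → Bool) :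
    (star M b).card = if M ≤ nDown b 0 N then 1 else 0 := by
  rw [star_eq, card_rank' (· = M), card_range_eq _ hM]

lemma disjoint_setU_star (M : ℕ) (b : Fin N → Bool) : Disjoint (setU M b) (star M b) := by
  rw [disjoint_left]
  intro d h1 h2
  rw [setU_eq, mem_filter] at h1
  rw [mem_star] at h2
  omega

lemma card_setV (hM : 1 ≤ M) (b : Fin N → Bool) : (setV M b).card = min (nDown b 0 N) M := by
  rw [setV, card_union_of_disjoint (disjoint_setU_star M b), card_setU, card_star hM]
  split_ifs <;> omega

lemma card_dashed (M : ℕ) (b : Fin N → Bool) : (dashed M b).card = (nDown b 0 N - M) / 2 := by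
  rw [← card_image_of_injOn dashed_fst_inj, image_dashed,
    card_rank' (fun t => M < t ∧ Even (t - M)), card_range_even]

lemma N1_eq (M : ℕ) (b : Fin N → Bool) : N1 M b = (nDown b 0 N - M) % 2 := by
  rw [N1, unpaired_eq]
  rcases Nat.even_or_odd (nDown b 0 N - M) with h | h
  · rw [filter_false_of_mem, card_empty]
    · rw [Nat.even_iff] at h; omega
    · rintro d _ ⟨_, h2, h3⟩
      rw [h2] at h3
      exact h3 h
  · obtain ⟨d, hd, hd'⟩ := exists_rank (b := b) (k := nDown b 0 N)
      (by rw [Nat.odd_iff] at h; omega) le_rfl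
    rw [Nat.odd_iff] at h
    rw [h, card_eq_one]
    refine ⟨d, ?_⟩
    ext e
    simp only [mem_filter, mem_singleton]
    constructor
    · rintro ⟨h1, h2, h3, -⟩
      exact rank_inj h1 hd (h3.trans hd'.symm)
    · rintro rfl
      rw [hd', Nat.even_iff]
      exact ⟨hd, by omega, rfl, by omega⟩

lemma rightItems_eq (M : ℕ) (b : Fin N → Bool) : rightItems M b = (arcs b).image Prod.fst ∪
    (downs b).filter fun d => rank b d ≤ M ∨ Even (rank b d - M) := by
  rw [rightItems, image_dashed, setU_eq, star_eq]
  ext d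
  simp only [mem_union, mem_filter, Nat.even_iff]
  by_cases hd : d ∈ downs b
  · simp only [hd, true_and, or_assoc]
    refine or_congr_right ?_
    omega
  · simp [hd]

lemma arcs_fst_inj : Set.InjOn Prod.fst (arcs b : Set (Fin N × Fin N)) :=
  fun _ hA _ hB h => arc_fst_inj hA hB (congrArg Fin.val h)

lemma card_arcs_of_iff {p : Fin N × Fin N → Prop} [DecidablePred p]
    (h : ∀ A ∈ arcs b, p A ↔ i ≤ (A.1 : ℕ) ∧ (A.1 : ℕ) < j) :
    ((arcs b).filter p).card = nArc b i j := by
  rw [nArc, arcSum, segSum, ← card_eq_sum_ones, filter_congr h]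

lemma card_ups_of_iff {p : Fin N → Prop} [DecidablePred p]
    (h : ∀ A ∈ ups b, p A ↔ i ≤ (A : ℕ) ∧ (A : ℕ) < j) :
    ((ups b).filter p).card = nUp b i j := by
  rw [nUp, upSum, segSum, ← card_eq_sum_ones, filter_congr h]

lemma disjoint_arcs_downs (b : Fin N → Bool) (p : Fin N → Prop) [DecidablePred p] :
    Disjoint ((arcs b).image Prod.fst) ((downs b).filter p) := by
  rw [disjoint_left]
  intro d h1 h2
  obtain ⟨A, hA, rfl⟩ := mem_image.1 h1
  exact downs_ne_fst (mem_filter.1 h2).1 hA rfl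

lemma rightNum_eq (M : ℕ) (b : Fin N → Bool) (d : Fin N) : rightNum M b d = downNum M b d := by
  rw [rightNum, rightItems_eq, filter_union, card_union_of_disjoint
    (disjoint_of_subset_left (filter_subset _ _) (disjoint_of_subset_right (filter_subset _ _)
      (disjoint_arcs_downs _ _))), filter_image, card_image_of_injOn
      (arcs_fst_inj (b := b) |>.mono (coe_subset.2 (filter_subset _ _))), downNum, filter_filter]
  congr 1
  · exact card_arcs_of_iff fun A _ => by simp only [Fin.le_def]; omega
  · rw [rank_eq b d, ← card_range_items,
      ← card_rank (b := b) (fun t => t ≤ M ∨ Even (t - M)) d]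
    rfl

/-- The down arrows which are left ends of items or unpaired, apart from the star. -/
lemma leftItems_eq (M : ℕ) (b : Fin N → Bool) : leftItems M b = ups b ∪
    ((arcs b).image Prod.fst ∪ (downs b).filter fun d => rank b d < M ∨
      (M < rank b d ∧ Even (rank b d - M)) ∨
      (M < rank b d ∧ rank b d = nDown b 0 N ∧ ¬Even (rank b d - M))) := by
  rw [leftItems, image_dashed, setU_eq, unpaired_eq]
  ext d
  simp only [mem_union, mem_filter]
  by_cases hd : d ∈ downs b <;> simp only [hd, true_and, false_and] <;> tauto

lemma disjoint_ups (b : Fin N → Bool) (p : Fin N → Prop) [DecidablePred p] :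
    Disjoint (ups b) ((arcs b).image Prod.fst ∪ (downs b).filter p) := by
  rw [disjoint_left]
  intro d h1 h2
  rcases mem_union.1 h2 with h2 | h2
  · obtain ⟨A, hA, rfl⟩ := mem_image.1 h2
    exact ups_ne_fst h1 hA rfl
  · exact ups_ne_downs h1 (mem_filter.1 h2).1 rfl

lemma leftNum_up (M : ℕ) {u : Fin N} (hu : u ∈ ups b) :
    leftNum M b u = nArc b 0 (u + 1) + nUp b 0 (u + 1) := by
  rw [leftNum, leftItems_eq, filter_union, filter_union, card_union_of_disjoint
    (disjoint_of_subset_left (filter_subset _ _) (disjoint_of_subset_right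
      (union_subset_union (filter_subset _ _) (filter_subset _ _)) (disjoint_ups _ _))),
    (filter_eq_empty_iff (s := (downs b).filter _)).2, union_empty, filter_image,
    card_image_of_injOn (arcs_fst_inj (b := b) |>.mono (coe_subset.2 (filter_subset _ _))), add_comm]
  · congr 1
    · exact card_arcs_of_iff fun A _ => by simp only [Fin.le_def]; omega
    · exact card_ups_of_iff fun A _ => by simp only [Fin.le_def]; omega
  · intro d hd h
    have := ups_lt_downs hu (mem_filter.1 hd).1
    simp only [Fin.le_def] at h
    omega

lemma card_arcs (b : Fin N → Bool) : (arcs b).card = nArc b 0 N := by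
  rw [← card_arcs_of_iff (p := fun _ => True) (by simp), filter_true_of_mem (by simp)]

lemma card_ups (b : Fin N → Bool) : (ups b).card = nUp b 0 N := by
  rw [← card_ups_of_iff (p := fun _ => True) (by simp), filter_true_of_mem (by simp)]

lemma card_leftItems (M : ℕ) (b : Fin N → Bool) : (leftItems M b).card =
    nUp b 0 N + nArc b 0 N + (min (nDown b 0 N) (M - 1) + (nDown b 0 N - M) / 2 +
      (nDown b 0 N - M) % 2) := by
  rw [leftItems_eq, card_union_of_disjoint (disjoint_ups _ _),
    card_union_of_disjoint (disjoint_arcs_downs _ _), card_image_of_injOn arcs_fst_inj,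
    card_ups, card_arcs, filter_or, filter_or, ← setU_eq, ← image_dashed, ← unpaired_eq,
    card_union_of_disjoint, card_union_of_disjoint, card_setU,
    card_image_of_injOn dashed_fst_inj, card_dashed, ← N1, N1_eq]
  · ring
  · rw [image_dashed, unpaired_eq, disjoint_filter]
    tauto
  · rw [image_dashed, unpaired_eq, setU_eq, ← filter_or, disjoint_filter]
    omega

end Rank

end TypeBI
namespace TypeBI

open Finset

section Simplify

variable {N M : ℕ} {b : Fin N → Bool} {i j k : ℕ} {c d s : Fin N}

local notation "𝐪" => (RatFunc.X : RatFunc ℂ)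

lemma nUp_down_zero (hd : d ∈ downs b) : nUp b d N = 0 :=
  nUp_eq_zero fun u hu => by
    have := ups_lt_downs hu hd
    omega

lemma length_down (hd : d ∈ downs b) : N = d + 2 * nArc b d N + rank b d := by
  have := (Closed.down' hd).length
  rw [nUp_down_zero hd, ← rank_eq] at this
  omega

lemma nArc_anti (h : i ≤ j) (hj : j ≤ N) : nArc b j N ≤ nArc b i N := by
  rw [nArc_add h hj]; omega

lemma arc_snd_lt {A : Fin N × Fin N} (hA : A ∈ arcs b) (hd : d ∈ downs b) :
    (A.2 : ℕ) < d ↔ (A.1 : ℕ) ≤ d := by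
  have h1 := arc_lt hA
  have h2 := downs_ne_fst hd hA
  have h3 := downs_not_inside hd hA
  omega

lemma lt_arc_fst {A : Fin N × Fin N} (hd : d ∈ downs b) :
    (d : ℕ) < A.1 ↔ nDown b A.1 N < rank b d := by
  rw [← not_le, ← rank_le_nDown hd A.1.2.le, not_le]

lemma mem_star_iff (hs : s ∈ downs b) (hs' : rank b s = M) : d ∈ star M b ↔ d = s := by
  rw [mem_star]
  exact ⟨fun h => rank_inj h.1 hs (h.2.trans hs'.symm), fun h => h ▸ ⟨hs, hs'⟩⟩

lemma mem_marked_iff (hM : 1 ≤ M) (hc : c ∈ downs b) (hc' : rank b c = 1) :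
    d ∈ marked M b M ↔ d = c := by
  rw [mem_marked_self hM]
  exact ⟨fun h => rank_inj h.1 hc (h.2.trans hc'.symm), fun h => h ▸ ⟨hc, hc'⟩⟩

lemma markedPos_star (hs : s ∈ downs b) (hs' : rank b s = M) : markedPos M b 1 = s + 1 := by
  have : marked M b 1 = {s} := by
    ext d; rw [mem_singleton]; exact mem_star_iff hs hs'
  rw [markedPos, this, sum_singleton, pos]

lemma markedPos_self (hM : 1 ≤ M) (hc : c ∈ downs b) (hc' : rank b c = 1) :
    markedPos M b M = c + 1 := by
  have : marked M b M = {c} := by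
    ext d; rw [mem_singleton]; exact mem_marked_iff hM hc hc'
  rw [markedPos, this, sum_singleton, pos]

lemma mem_setSR (hM : 1 ≤ M) (hc : c ∈ downs b) (hc' : rank b c = 1) {A : Fin N × Fin N} :
    A ∈ setSR M b ↔ A ∈ arcs b ∧ (c : ℕ) < A.1 := by
  simp [setSR, mem_marked_iff hM hc hc']

open Classical in
lemma prod_outer_setSR {R : Type*} [CommMonoid R] (hM : 1 ≤ M) (hc : c ∈ downs b)
    (hc' : rank b c = 1) (f : Fin N × Fin N → R) :
    ∏ A ∈ outer M b ∩ setSR M b, f A =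
      arcProd b (fun A => if IsOuter b A then f A else 1) (c + 1) N := by
  rw [arcProd, segProd, ← prod_filter]
  refine prod_congr ?_ fun _ _ => rfl
  ext A
  simp only [mem_inter, outer, mem_filter, mem_setSR hM hc hc']
  constructor
  · rintro ⟨⟨h1, h2⟩, -, h3⟩
    exact ⟨⟨h1, h3, A.1.2⟩, fun B hB => h2 B (mem_union_left _ hB)⟩
  · rintro ⟨⟨h1, h3, -⟩, h4⟩
    refine ⟨⟨h1, fun B hB hBA => ?_⟩, h1, h3⟩
    rcases mem_union.1 hB with hB | hB
    · exact h4 B hB hBA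
    · obtain ⟨e1, e2, e3, e4, e5⟩ := mem_dashed.1 hB
      have h5 : (c : ℕ) < B.2 := by
        have := arc_lt h1
        have := Fin.lt_def.1 hBA.2
        omega
      rw [← rank_lt_rank hc] at h5
      omega

lemma prod_outer_setSR_div (hM : 1 ≤ M) (hc : c ∈ downs b) (hc' : rank b c = 1)
    (F : ℕ → RatFunc ℂ) (hF : ∀ l, (c : ℕ) + 1 ≤ l → l ≤ N → F l ≠ 0) :
    ∏ A ∈ outer M b ∩ setSR M b, F A.1 / F (A.2 + 1) = F (c + 1) / F N := by
  classical
  rw [prod_outer_setSR hM hc hc']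
  refine arcProd_telescope F hF (Closed.down hc) ?_ ?_ fun B hB h => by omega
  · rw [← nUp_down hc c.2, nUp_down_zero hc]
  · have := rank_eq_succ hc
    omega

lemma downNum_of_le (h : rank b d ≤ M) : downNum M b d = nArc b d N + rank b d := by
  simp only [downNum, downItems]; omega

lemma downNum_of_even (h : M ≤ rank b d) (h' : Even (rank b d - M)) :
    2 * downNum M b d = 2 * nArc b d N + rank b d + M := by
  obtain ⟨x, hx⟩ := h'
  simp only [downNum, downItems]; omega

theorem N7_eq (hM : 1 ≤ M) (hc : c ∈ downs b) (hc' : rank b c = 1) :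
    N7 𝐪 M b = ∏ C ∈ setU M b,
      qInt 𝐪 (downNum M b C - nArc b c N) / qInt 𝐪 (downNum M b C) := by
  refine prod_congr rfl fun C hC => ?_
  rw [setU_eq, mem_filter] at hC
  have h1 := length_down hC.1
  have h2 := length_down hc
  have h3 := (rank_le_rank hc (e := C)).1 (by have := rank_pos hC.1; omega)
  have h4 := nArc_anti (b := b) h3 c.2.le
  have h5 := rank_pos hC.1
  have h6 := downNum_of_le (b := b) (d := C) hC.2.le
  trans ∏ A ∈ outer M b ∩ setSR M b,
    qInt 𝐪 ((A.1 + 1 - pos C + rank b C) / 2) / qInt 𝐪 ((A.2 + 1 + 1 - pos C + rank b C) / 2)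
  · refine prod_congr rfl fun A hA => ?_
    rw [mem_inter, mem_setSR hM hc hc'] at hA
    have h7 := snd_eq hA.2.1
    have e1 : d1 M b A C = (A.1 + 1 - pos C + rank b C) / 2 := by
      simp only [d1, pos, label]; omega
    have e2 : d1 M b A C + size A = (A.2 + 1 + 1 - pos C + rank b C) / 2 := by
      simp only [d1, pos, label]; omega
    rw [e2, e1]
  · rw [prod_outer_setSR_div hM hc hc' (fun l => qInt 𝐪 ((l + 1 - pos C + rank b C) / 2))]
    · congr 2
      · simp only [pos]; omega
      · simp only [pos]; omega
    · intro l hl hl'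
      exact qInt_ne_zero (by simp only [pos]; omega)

lemma d4_eq (hM : 1 ≤ M) (hc : c ∈ downs b) (hc' : rank b c = 1) (hd : d ∈ downs b)
    (h : rank b d ≤ M) : d4 M b d = downNum M b d - nArc b c N := by
  have h1 := length_down hd
  have h2 := length_down hc
  have h3 := (rank_le_rank hc (e := d)).1 (by have := rank_pos hd; omega)
  have h4 := nArc_anti (b := b) h3 c.2.le
  have h5 := rank_pos hd
  rw [d4, markedPos_self hM hc hc', downNum_of_le h, label, pos]
  omega

lemma d5_eq (hM : 1 ≤ M) (hc : c ∈ downs b) (hc' : rank b c = 1) {E : Fin N × Fin N}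
    (hE : E ∈ dashed M b) : d5 M b E = downNum M b E.1 - nArc b c N := by
  obtain ⟨e1, e2, e3, e4, e5⟩ := mem_dashed.1 hE
  have h1 := length_down e1
  have h2 := length_down hc
  have h3 := (rank_le_rank hc (e := E.1)).1 (by omega)
  have h4 := nArc_anti (b := b) h3 c.2.le
  have h5 := downNum_of_even (b := b) (d := E.1) (M := M) (by omega)
    (by rw [Nat.odd_iff] at e4; rw [Nat.even_iff]; omega)
  rw [d5, markedPos_self hM hc hc', pos]
  omega

lemma mem_setSW (hs : s ∈ downs b) (hs' : rank b s = M) {A : Fin N × Fin N} :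
    A ∈ setSW M b ↔ A ∈ arcs b ∧ (A.2 : ℕ) < s ∧ ((∃ u ∈ unpaired M b, u < A.1) ∨
      (unpaired M b = ∅ ∧ ∃ E ∈ dashed M b, E.1 < A.1)) := by
  simp [setSW, mem_star_iff hs hs']

/-- The number of the dashed arc `E` in the enumeration from the right of the dashed arcs and of
the arcs in `S_W`, where the latter are sorted by their right ends. -/
def dashNum (M : ℕ) (b : Fin N → Bool) (s : Fin N) (E : Fin N × Fin N) : ℕ :=
  nArc b E.1 s + (rank b E.1 - M) / 2

theorem prod_hgt {R : Type*} [CommMonoid R] (hs : s ∈ downs b) (hs' : rank b s = M)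
    (f : ℕ → R) :
    (∏ A ∈ setSW M b, f (hgt M b A)) * ∏ E ∈ dashed M b, f (dashNum M b s E) =
      ∏ t ∈ range (N3 M b), f (t + 1) := by
  have hsub : setSW M b ⊆ arcs b := filter_subset _ _
  have hinj : Set.InjOn Prod.snd (arcs b : Set (Fin N × Fin N)) :=
    fun A hA B hB h => arc_snd_inj hA hB (congrArg Fin.val h)
  have hdisj : Disjoint ((setSW M b).image Prod.snd) ((dashed M b).image Prod.fst) := by
    rw [disjoint_left]
    intro d h1 h2
    obtain ⟨A, hA, rfl⟩ := mem_image.1 h1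
    rw [image_dashed] at h2
    exact downs_ne_snd (mem_filter.1 h2).1 (hsub hA) rfl
  have hcard : ((setSW M b).image Prod.snd ∪ (dashed M b).image Prod.fst).card = N3 M b := by
    rw [card_union_of_disjoint hdisj, card_image_of_injOn dashed_fst_inj,
      card_image_of_injOn (hinj.mono (coe_subset.2 hsub)), N3]
  have hnum : ∀ a : Fin N, (((setSW M b).image Prod.snd ∪ (dashed M b).image Prod.fst).filter
      fun k => a ≤ k).card = ((setSW M b).filter fun B => a ≤ B.2).card +
        ((dashed M b).filter fun E => a ≤ E.1).card := by
    intro a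
    rw [filter_union, card_union_of_disjoint (disjoint_of_subset_left (filter_subset _ _)
      (disjoint_of_subset_right (filter_subset _ _) hdisj)), filter_image, filter_image,
      card_image_of_injOn (hinj.mono (coe_subset.2 ((filter_subset _ _).trans hsub))),
      card_image_of_injOn (dashed_fst_inj.mono (coe_subset.2 (filter_subset _ _)))]
  rw [← hcard, ← prod_card_ge, prod_union hdisj, prod_image (hinj.mono (coe_subset.2 hsub)),
    prod_image dashed_fst_inj]
  congr 1
  · refine prod_congr rfl fun A hA => ?_
    have hA' := hsub hA
    rw [hnum, hgt]
    congr 2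
    · congr 1
      refine filter_congr fun B hB => ?_
      have h1 := arc_lt (hsub hB)
      have h2 := arc_nested hA' (hsub hB)
      simp only [Fin.le_def, Fin.lt_def]
      omega
    · congr 1
      refine filter_congr fun E hE => ?_
      have := downs_ne_snd (mem_dashed.1 hE).1 hA'
      simp only [Fin.le_def, Fin.lt_def]
      omega
  · refine prod_congr rfl fun E hE => ?_
    obtain ⟨e1, e2, e3, e4, e5⟩ := mem_dashed.1 hE
    rw [hnum, dashNum]
    congr 2
    · symm
      rw [← card_arcs_of_iff (p := fun A => A ∈ setSW M b ∧ E.1 ≤ A.2)]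
      · congr 1
        ext A
        simp only [mem_filter]
        exact ⟨fun h => ⟨hsub h.1, h⟩, fun h => h.2⟩
      · intro A hA
        rw [mem_setSW hs hs', Fin.le_def, arc_snd_lt hA hs]
        have h1 := arc_snd_lt hA e1
        have h2 := downs_ne_snd e1 hA
        have h3 := downs_ne_fst e1 hA
        have h4 := downs_ne_fst hs hA
        constructor
        · rintro ⟨⟨-, h5, -⟩, h6⟩
          omega
        · rintro ⟨h5, h6⟩
          refine ⟨⟨hA, h6.le, ?_⟩, by have := arc_lt hA; omega⟩
          rcases (unpaired M b).eq_empty_or_nonempty with h7 | ⟨u, hu⟩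
          · exact Or.inr ⟨h7, E, hE, Fin.lt_def.2 (by omega)⟩
          · refine Or.inl ⟨u, hu, Fin.lt_def.2 ?_⟩
            obtain ⟨u1, u2, u3, u4⟩ := mem_unpaired.1 hu
            have h8 := (rank_le_rank e1 (e := u)).1 (by rw [u3]; exact rank_le b _)
            have h9 := downs_ne_fst u1 hA
            omega
    · rw [← card_image_of_injOn (dashed_fst_inj.mono (coe_subset.2 (filter_subset _ _))),
        ← filter_image (p := fun d => E.1 ≤ d), image_dashed, filter_filter, rank_eq b E.1,
        ← card_range_even,
        ← card_rank (b := b) (fun t : ℕ => M < t ∧ Even (t - M)) (E.1 : ℕ)]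
      rfl

theorem N8_eq (hM : 1 ≤ M) (hc : c ∈ downs b) (hc' : rank b c = 1) (hs : s ∈ downs b)
    (hs' : rank b s = M) :
    N8 𝐪 M b = qInt 𝐪 (downNum M b s - nArc b c N) / qInt 𝐪 (downNum M b s) *
      ∏ E ∈ dashed M b, qInt 𝐪 (downNum M b E.1 - nArc b c N) / qInt 𝐪 (downNum M b E.1) := by
  have hr := rank_le b s
  have h1 := length_down hs
  have h2 := length_down hc
  have h3 := (rank_le_rank hc (e := s)).1 (by omega)
  have h4 := nArc_anti (b := b) h3 c.2.le
  have h6 := downNum_of_le (b := b) (d := s) hs'.le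
  set y : ℕ → ℕ := fun l => (l + 1 - (s + 1) + M) / 2 with hy
  set F : ℕ → RatFunc ℂ := fun l =>
    qInt 𝐪 (y l) * ∏ E ∈ dashed M b, qInt 𝐪 (y l + dashNum M b s E) with hF
  have hy0 : ∀ l, (c : ℕ) + 1 ≤ l → 0 < y l := fun l hl => by simp only [hy]; omega
  have hprod : ∀ l : ℕ, 0 < y l → ∏ t ∈ range (N3 M b + 1), qInt 𝐪 (y l + t) =
      F l * ∏ A ∈ setSW M b, qInt 𝐪 (y l + hgt M b A) := by
    intro l hl
    rw [prod_range_succ', ← prod_hgt hs hs' (fun t => qInt 𝐪 (y l + t)), add_zero]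
    simp only [hF]; ring
  rw [N8, if_pos (by rw [card_setV hM]; omega)]
  trans ∏ A ∈ outer M b ∩ setSR M b, F A.1 / F (A.2 + 1)
  · refine prod_congr rfl fun A hA => ?_
    rw [mem_inter, mem_setSR hM hc hc'] at hA
    have h7 := snd_eq hA.2.1
    have e1 : d2 M b A = y A.1 := by
      simp only [d2, pos, markedPos_star hs hs', hy]
    have e2 : d2 M b A + size A = y (A.2 + 1) := by
      simp only [d2, pos, markedPos_star hs hs', hy]; omega
    have p1 := hy0 A.1 (by omega)
    have p2 := hy0 (A.2 + 1) (by omega)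
    rw [prod_div_distrib, prod_div_distrib, e2, e1, hprod _ p1, hprod _ p2]
    have z1 : ∏ A' ∈ setSW M b, qInt 𝐪 (y A.1 + hgt M b A') ≠ 0 :=
      prod_ne_zero_iff.2 fun _ _ => qInt_ne_zero (by omega)
    have z2 : ∏ A' ∈ setSW M b, qInt 𝐪 (y (A.2 + 1) + hgt M b A') ≠ 0 :=
      prod_ne_zero_iff.2 fun _ _ => qInt_ne_zero (by omega)
    field_simp
  · rw [prod_outer_setSR_div hM hc hc' F]
    · simp only [hF]
      rw [mul_div_mul_comm, ← prod_div_distrib]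
      congr 1
      · congr 2 <;> simp only [hy] <;> omega
      · refine prod_congr rfl fun E hE => ?_
        obtain ⟨e1, e2, e3, e4, e5⟩ := mem_dashed.1 hE
        have k1 := (rank_le_rank hs (e := E.1)).1 (by omega)
        have k2 := nArc_add (b := b) k1 s.2.le
        have k3 := downNum_of_even (b := b) (d := E.1) (M := M) (by omega)
          (by rw [Nat.odd_iff] at e4; rw [Nat.even_iff]; omega)
        rw [Nat.odd_iff] at e4
        congr 2 <;> simp only [hy, dashNum] <;> omega
    · intro l hl _
      exact mul_ne_zero (qInt_ne_zero (hy0 l hl)) (prod_ne_zero_iff.2 fun _ _ =>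
        qInt_ne_zero (by have := hy0 l hl; omega))

end Simplify

end TypeBI
namespace TypeBI

open Finset

section Simplify

variable {N M : ℕ} {b : Fin N → Bool} {i j k : ℕ} {c d s : Fin N}

local notation "𝐪" => (RatFunc.X : RatFunc ℂ)

lemma unpaired_eq_empty (h : Even (nDown b 0 N - M)) : unpaired M b = ∅ := by
  rw [← card_eq_zero, ← N1, N1_eq, Nat.even_iff.1 h]

lemma card_setSW (hs : s ∈ downs b) (hs' : rank b s = M) (hd : d ∈ downs b)
    (hd' : rank b d = nDown b 0 N) (he : Even (nDown b 0 N - M)) :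
    (setSW M b).card = nArc b d s := by
  rw [← card_arcs_of_iff (p := fun A => A ∈ setSW M b)]
  · congr 1
    ext A
    simp only [mem_filter]
    exact ⟨fun h => ⟨(mem_filter.1 h).1, h⟩, fun h => h.2⟩
  · intro A hA
    rw [mem_setSW hs hs', unpaired_eq_empty he, arc_snd_lt hA hs]
    have h1 := downs_ne_fst hs hA
    have h2 := downs_ne_fst hd hA
    have h3 := rank_le b s
    constructor
    · rintro ⟨-, h4, h5⟩
      rcases h5 with ⟨u, hu, -⟩ | ⟨-, E, hE, hE'⟩
      · simp at hu
      · have h6 := (rank_le_rank (mem_dashed.1 hE).1 (e := d)).1 (by rw [hd']; exact rank_le b _)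
        have h7 := Fin.lt_def.1 hE'
        omega
    · rintro ⟨h4, h5⟩
      refine ⟨hA, h5.le, Or.inr ⟨rfl, ?_⟩⟩
      have h6 := (rank_lt_rank hd (d := s)).2 (by omega)
      have : d ∈ (dashed M b).image Prod.fst := by
        rw [image_dashed, mem_filter, hd']
        exact ⟨hd, by omega, he⟩
      obtain ⟨E, hE, rfl⟩ := mem_image.1 this
      exact ⟨E, hE, Fin.lt_def.2 (by omega)⟩

lemma card_setSW' (hM : 1 ≤ M) (hc : c ∈ downs b) (hc' : rank b c = 1) (hs : s ∈ downs b)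
    (hs' : rank b s = M) : (setSW' M b).card = nArc b s c := by
  refine card_arcs_of_iff fun A hA => ?_
  simp only [mem_star_iff hs hs', exists_eq_left, mem_marked_iff hM hc hc', Fin.lt_def,
    arc_snd_lt hA hc]
  have := downs_ne_fst hs hA
  have := downs_ne_fst hc hA
  omega

lemma card_setSR (hM : 1 ≤ M) (hc : c ∈ downs b) (hc' : rank b c = 1) :
    (setSR M b).card = nArc b c N := by
  refine card_arcs_of_iff fun A hA => ?_
  simp only [mem_marked_iff hM hc hc', exists_eq_left, Fin.lt_def]
  have := downs_ne_fst hc hA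
  have := A.1.2
  omega

lemma N4_eq (hM : 1 ≤ M) (hc : c ∈ downs b) (hc' : rank b c = 1) (hs : s ∈ downs b)
    (hs' : rank b s = M) (hd : d ∈ downs b) (hd' : rank b d = nDown b 0 N)
    (he : Even (nDown b 0 N - M)) : N4 M b = downNum M b d - nArc b c N := by
  have h0 := rank_le b s
  have h1 := (rank_le_rank hs (e := d)).1 (by omega)
  have h2 := (rank_le_rank hc (e := s)).1 (by omega)
  have h3 := nArc_add (b := b) h1 s.2.le
  have h4 := nArc_add (b := b) h2 c.2.le
  rw [N4, card_setSW hs hs' hd hd' he, card_setSW' hM hc hc' hs hs', card_dashed]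
  simp only [downNum, downItems, hd']
  omega

/-- The position following the last unpaired up arrow. -/
def cut (b : Fin N → Bool) : ℕ := (ups b).sup fun u => (u : ℕ) + 1

lemma lt_cut {u : Fin N} (hu : u ∈ ups b) : (u : ℕ) < cut b :=
  le_sup (f := fun u : Fin N => (u : ℕ) + 1) hu

lemma cut_eq (b : Fin N → Bool) : (ups b = ∅ ∧ cut b = 0) ∨ ∃ u ∈ ups b, cut b = u + 1 := by
  rcases (ups b).eq_empty_or_nonempty with h | h
  · exact Or.inl ⟨h, by simp [cut, h]⟩
  · obtain ⟨u, hu, h⟩ := exists_mem_eq_sup _ h fun u : Fin N => (u : ℕ) + 1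
    exact Or.inr ⟨u, hu, h⟩

lemma closed_cut (b : Fin N → Bool) : Closed b (cut b) N := by
  rcases cut_eq b with ⟨-, h⟩ | ⟨u, hu, h⟩
  · rw [h]; exact Closed.univ b
  · rw [h]; exact Closed.up hu

lemma cut_le (b : Fin N → Bool) : cut b ≤ N := (closed_cut b).le

lemma closed_cut' (b : Fin N → Bool) : Closed b 0 (cut b) :=
  (Closed.univ b).diff (Nat.zero_le _) (cut_le b) (closed_cut b)

lemma cut_le_down (hd : d ∈ downs b) : cut b ≤ d :=
  Finset.sup_le fun _ hu => ups_lt_downs hu hd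

lemma nUp_cut (b : Fin N → Bool) : nUp b (cut b) N = 0 :=
  nUp_eq_zero fun u hu => by have := lt_cut hu; omega

lemma nDown_cut (b : Fin N → Bool) : nDown b 0 (cut b) = 0 :=
  nDown_eq_zero fun d hd => by have := cut_le_down hd; omega

lemma nDown_cut' (b : Fin N → Bool) : nDown b (cut b) N = nDown b 0 N := by
  have := nDown_add (b := b) (Nat.zero_le (cut b)) (cut_le b)
  rw [nDown_cut] at this
  omega

lemma ups_lt_iff {A : Fin N × Fin N} :
    (∀ u ∈ ups b, u < A.1) ↔ cut b ≤ A.1 := by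
  constructor
  · exact fun h => Finset.sup_le fun u hu => Fin.lt_def.1 (h u hu)
  · exact fun h u hu => Fin.lt_def.2 ((lt_cut hu).trans_le h)

lemma card_setSL (hs : s ∈ downs b) (hs' : rank b s = M) (hd : d ∈ downs b)
    (hd' : rank b d = nDown b 0 N) : (setSL M b).card = nArc b (cut b) d := by
  refine card_arcs_of_iff fun A hA => ?_
  rw [ups_lt_iff]
  have hA' := downs_ne_fst hd hA
  constructor
  · rintro ⟨-, h1, h2⟩
    have := Fin.lt_def.1 (h1 d hd)
    rw [arc_snd_lt hA hd] at this
    omega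
  · rintro ⟨h1, h2⟩
    refine ⟨⟨s, mem_star.2 ⟨hs, hs'⟩⟩, fun C hC => Fin.lt_def.2 ?_, h1⟩
    have h3 := (rank_le_rank hC (e := d)).1 (by rw [hd']; exact rank_le b _)
    exact (arc_snd_lt hA hC).2 (by omega)

lemma N5_eq (hM : 1 ≤ M) (hc : c ∈ downs b) (hc' : rank b c = 1) (hs : s ∈ downs b)
    (hs' : rank b s = M) (hd : d ∈ downs b) (hd' : rank b d = nDown b 0 N)
    (he : Even (nDown b 0 N - M)) :
    N5 M b = 2 * (nArc b (cut b) N + downItems M (nDown b (cut b) N)) +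
      (nArc b 0 (cut b) + nUp b 0 (cut b)) := by
  have h0 := rank_le b s
  have h1 := (rank_le_rank hs (e := d)).1 (by omega)
  have h2 := (rank_le_rank hc (e := s)).1 (by omega)
  have h3 := nArc_add (b := b) h1 s.2.le
  have h4 := nArc_add (b := b) h2 c.2.le
  have h5 := nArc_add (b := b) (cut_le_down hd) d.2.le
  have h6 := nArc_add (b := b) (Nat.zero_le (cut b)) (cut_le b)
  have h7 := (closed_cut b).length
  have h8 := (closed_cut' b).length
  have h9 := nUp_cut b
  have h10 := nDown_cut b
  have h11 := nDown_cut' b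
  obtain ⟨x, hx⟩ := he
  rw [N5, card_setSW hs hs' hd hd' ⟨x, hx⟩, card_setSW' hM hc hc' hs hs', card_setSR hM hc hc',
    card_setSL hs hs' hd hd', card_arcs]
  simp only [downItems]
  omega

/-- The factor of `psi` which is present only if all down arrows outside of the arcs are
paired or carry an integer, and one of them is the star. -/
noncomputable def tailWeight (M : ℕ) (b : Fin N → Bool) : RatFunc ℂ :=
  if M ≤ nDown b 0 N ∧ Even (nDown b 0 N - M) then qInt 𝐪 (N5 M b) else 1

lemma prod_setU' (hc : c ∈ downs b) (hc' : rank b c = 1) :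
    ∏ C ∈ setU' M b, qInt 𝐪 (downNum M b C - nArc b c N) =
      ∏ C ∈ setU M b, qInt 𝐪 (downNum M b C - nArc b c N) := by
  refine prod_subset ?_ fun C hC hC' => ?_
  · rw [setU'_eq, setU_eq]
    exact fun C hC => by rw [mem_filter] at hC ⊢; exact ⟨hC.1, hC.2.2⟩
  · rw [setU_eq, mem_filter] at hC
    rw [setU'_eq, mem_filter] at hC'
    have h1 := rank_pos hC.1
    have h2 : rank b C = 1 := by
      by_contra h
      exact hC' ⟨hC.1, by omega, hC.2⟩
    obtain rfl := rank_inj hC.1 hc (h2.trans hc'.symm)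
    rw [downNum_of_le hC.2.le, h2, Nat.add_sub_cancel_left, qInt_one]

lemma prod_setV' (s_mem : s ∈ downs b) (hs' : rank b s = M) (f : Fin N → RatFunc ℂ) :
    ∏ C ∈ setV' M b, f C = (∏ C ∈ setU' M b, f C) * f s := by
  have hst : star M b = {s} := by
    ext d; rw [mem_singleton]; exact mem_star_iff s_mem hs'
  rw [setV', hst, prod_union, prod_singleton]
  rw [disjoint_singleton_right, setU'_eq, mem_filter]
  omega

lemma downNum_sub_pos (hM : 1 ≤ M) (hc : c ∈ downs b) (hc' : rank b c = 1) (hd : d ∈ downs b) :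
    0 < downNum M b d - nArc b c N := by
  have h1 := rank_pos hd
  have h2 := nArc_anti (b := b) ((rank_le_rank hc (e := d)).1 (by omega)) c.2.le
  simp only [downNum, downItems]
  omega

theorem prod_N6_N7_N8_N10 (hM : 1 ≤ M) (b : Fin N → Bool) :
    N6 𝐪 M b * N7 𝐪 M b * N8 𝐪 M b * N10 𝐪 M b =
      (∏ C ∈ setU M b, (qInt 𝐪 (downNum M b C))⁻¹) * (∏ C ∈ star M b, (qInt 𝐪 (downNum M b C))⁻¹) *
      (∏ E ∈ dashed M b, (qInt 𝐪 (downNum M b E.1))⁻¹) * tailWeight M b := by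
  rcases Nat.eq_zero_or_pos (nDown b 0 N) with h0 | h0
  · have hds : downs b = ∅ := by
      by_contra h
      obtain ⟨d, hd⟩ := nonempty_iff_ne_empty.2 h
      have := rank_le b d
      have := rank_pos hd
      omega
    have h1 : N1 M b = 0 := by rw [N1_eq, h0]; simp
    have h2 : (setV M b).card = 0 := by rw [card_setV hM, h0]; simp
    have h3 : dashed M b = ∅ := by rw [← card_eq_zero, card_dashed, h0]; simp
    rw [N6, N8, N10, tailWeight, N7, h1, h2, h3, setU_eq, setU'_eq, star_eq, hds, h0]
    simp [show ¬(0 = M) by omega, show ¬(M ≤ 0) by omega]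
  obtain ⟨c, hc, hc'⟩ := exists_rank (b := b) (k := 1) le_rfl h0
  have hU : ∀ C ∈ setU M b, qInt 𝐪 (downNum M b C - nArc b c N) ≠ 0 := fun C hC =>
    qInt_ne_zero (downNum_sub_pos hM hc hc' (mem_filter.1 hC).1)
  have hU0 := prod_ne_zero_iff.2 hU
  have hN7 : N7 𝐪 M b * ∏ C ∈ setU' M b, (qInt 𝐪 (d4 M b C))⁻¹ =
      ∏ C ∈ setU M b, (qInt 𝐪 (downNum M b C))⁻¹ := by
    have : ∏ C ∈ setU' M b, (qInt 𝐪 (d4 M b C))⁻¹ =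
        ∏ C ∈ setU' M b, (qInt 𝐪 (downNum M b C - nArc b c N))⁻¹ := by
      refine prod_congr rfl fun C hC => ?_
      rw [setU'_eq, mem_filter] at hC
      rw [d4_eq hM hc hc' hC.1 hC.2.2.le]
    rw [this, prod_inv_distrib, prod_setU' hc hc', N7_eq hM hc hc', prod_div_distrib,
      prod_inv_distrib]
    field_simp
  rcases lt_or_ge (nDown b 0 N) M with hr | hr
  · have h1 : N1 M b = 0 := by rw [N1_eq]; omega
    have h2 : (setV M b).card ≠ M := by rw [card_setV hM]; omega
    have h3 : dashed M b = ∅ := by rw [← card_eq_zero, card_dashed]; omega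
    have h4 : star M b = ∅ := by rw [← card_eq_zero, card_star hM, if_neg (by omega)]
    rw [← hN7, N6, N8, N10, tailWeight, h1, h3, h4, if_neg (by tauto), if_neg h2,
      if_neg (by omega), if_pos rfl, if_neg (by omega)]
    simp
  · obtain ⟨s, hs, hs'⟩ := exists_rank (b := b) hM hr
    have hst : star M b = {s} := by
      ext d; rw [mem_singleton]; exact mem_star_iff hs hs'
    have h2 : (setV M b).card = M := by rw [card_setV hM]; omega
    have hs0 := qInt_ne_zero (downNum_sub_pos (M := M) hM hc hc' hs)
    have hd4 := d4_eq hM hc hc' hs hs'.le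
    have hT : ∀ E ∈ dashed M b, qInt 𝐪 (downNum M b E.1 - nArc b c N) ≠ 0 := fun E hE =>
      qInt_ne_zero (downNum_sub_pos hM hc hc' (mem_dashed.1 hE).1)
    have hT0 := prod_ne_zero_iff.2 hT
    have hd5 : ∏ E ∈ dashed M b, (qInt 𝐪 (d5 M b E))⁻¹ =
        (∏ E ∈ dashed M b, qInt 𝐪 (downNum M b E.1 - nArc b c N))⁻¹ := by
      rw [← prod_inv_distrib]
      exact prod_congr rfl fun E hE => by rw [d5_eq hM hc hc' hE]
    rw [N8_eq hM hc hc' hs hs', hst, prod_singleton, ← hN7, prod_div_distrib,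
      prod_inv_distrib (f := fun E : Fin N × Fin N => qInt 𝐪 (downNum M b E.1))]
    rcases Nat.even_or_odd (nDown b 0 N - M) with he | ho
    · have h1 : N1 M b = 0 := by rw [N1_eq, Nat.even_iff.1 he]
      obtain ⟨d, hd, hd'⟩ := exists_rank (b := b) h0 le_rfl
      rw [N6, if_pos ⟨h2, h1⟩, tailWeight, if_pos ⟨hr, he⟩,
        N4_eq hM hc hc' hs hs' hd hd' he, N10, if_neg (by omega)]
      split_ifs with h3
      · have hds : d = s := rank_inj hd hs (by
          rw [← card_eq_zero, card_dashed] at h3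
          rw [Nat.even_iff] at he
          omega)
        rw [hds, h3]
        simp only [prod_empty]
        field_simp
      · obtain ⟨E, hE, rfl⟩ : ∃ E ∈ dashed M b, E.1 = d := by
          rw [← card_eq_zero, card_dashed] at h3
          have : d ∈ (dashed M b).image Prod.fst := by
            rw [image_dashed, mem_filter, hd']
            exact ⟨hd, by omega, he⟩
          exact mem_image.1 this
        have hT' : setT' M b = (dashed M b).erase E := by
          ext F
          rw [setT', mem_filter, mem_erase, and_comm]
          refine and_congr_left fun hF => ?_
          constructor
          · rintro ⟨G, hG, hG'⟩ rfl
            have := (rank_lt_rank (mem_dashed.1 hG).1).2 (Fin.lt_def.1 hG')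
            have := rank_le b G.1
            omega
          · intro hne
            refine ⟨E, hE, Fin.lt_def.2 ((rank_lt_rank hd).1 ?_)⟩
            rw [hd']
            refine lt_of_le_of_ne (rank_le b _) fun h => hne (dashed_fst_inj hF hE ?_)
            exact rank_inj (mem_dashed.1 hF).1 hd (h.trans hd'.symm)
        have hsplit : (qInt 𝐪 (downNum M b E.1 - nArc b c N))⁻¹ *
            ∏ F ∈ setT' M b, (qInt 𝐪 (d5 M b F))⁻¹ =
            (∏ E ∈ dashed M b, qInt 𝐪 (downNum M b E.1 - nArc b c N))⁻¹ := by
          rw [← hd5, hT', ← mul_prod_erase _ _ hE, d5_eq hM hc hc' hE]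
        rw [prod_setV' hs hs', hd4]
        have hE0 := hT E hE
        calc _ = qInt 𝐪 (N5 M b) * (N7 𝐪 M b * ∏ C ∈ setU' M b, (qInt 𝐪 (d4 M b C))⁻¹) *
              (qInt 𝐪 (downNum M b s - nArc b c N) / qInt 𝐪 (downNum M b s) *
                (qInt 𝐪 (downNum M b s - nArc b c N))⁻¹) *
              ((∏ E ∈ dashed M b, qInt 𝐪 (downNum M b E.1 - nArc b c N)) /
                (∏ E ∈ dashed M b, qInt 𝐪 (downNum M b E.1)) *
              ((qInt 𝐪 (downNum M b E.1 - nArc b c N))⁻¹ *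
                ∏ F ∈ setT' M b, (qInt 𝐪 (d5 M b F))⁻¹)) := by
              rw [div_eq_mul_inv (qInt 𝐪 (N5 M b))]; ring
          _ = _ := by
              rw [hsplit]; field_simp
    · have h1 : N1 M b = 1 := by rw [N1_eq, Nat.odd_iff.1 ho]
      rw [N6, if_neg (by omega), tailWeight, if_neg (by rw [← Nat.not_even_iff_odd] at ho; tauto),
        N10, if_pos h1, prod_setV' hs hs', hd4, hd5]
      field_simp

end Simplify

end TypeBI
namespace TypeBI

open Finset

section Assemble

variable {N M : ℕ} {b : Fin N → Bool}

local notation "𝐪" => (RatFunc.X : RatFunc ℂ)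

lemma isCorr_of_mem_setSW {A : Fin N × Fin N} (hA : A ∈ outer M b) (hA' : A ∈ setSW M b) :
    IsCorr M b A := by
  obtain ⟨hA1, hA2⟩ := mem_filter.1 hA
  obtain ⟨-, ⟨s, hs, hsA⟩, hAU⟩ := mem_filter.1 hA'
  obtain ⟨hs1, hs2⟩ := mem_star.1 hs
  have hA3 := arc_lt hA1
  have hs3 := Fin.lt_def.1 hsA
  have hM : M ≤ nDown b A.1 N := by
    rw [← hs2, rank_le_nDown hs1 A.1.2.le]; omega
  refine ⟨fun B hB => hA2 B (mem_union_left _ hB), fun u hu => ?_, hM, ?_⟩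
  · rw [Fin.lt_def]
    rcases hAU with ⟨v, hv, hvA⟩ | ⟨-, E, hE, hEA⟩
    · exact (ups_lt_downs hu (mem_filter.1 hv).1).trans (Fin.lt_def.1 hvA)
    · exact (ups_lt_downs hu (mem_dashed.1 hE).1).trans (Fin.lt_def.1 hEA)
  · by_contra hodd
    have hle := nDown_anti (b := b) (Nat.zero_le A.1) A.1.2.le
    have hlt : M < nDown b A.1 N := by
      rcases hM.eq_or_lt with h | h
      · rw [← h] at hodd; simp at hodd
      · exact h
    obtain ⟨d, hd, hd'⟩ := exists_rank (b := b) (k := nDown b A.1 N) (by omega) hle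
    have hAd : (A.1 : ℕ) ≤ d := (rank_le_nDown hd A.1.2.le).1 hd'.le
    rcases hle.eq_or_lt with h | h
    · have hdu : d ∈ unpaired M b := mem_unpaired.2 ⟨hd, by omega, by omega, by rwa [hd']⟩
      rcases hAU with ⟨v, hv, hvA⟩ | ⟨hU, -⟩
      · obtain ⟨v1, v2, v3, v4⟩ := mem_unpaired.1 hv
        have := (lt_arc_fst v1).1 (Fin.lt_def.1 hvA)
        omega
      · rw [hU] at hdu; simp at hdu
    · obtain ⟨e, he, he'⟩ := exists_rank (b := b) (k := nDown b A.1 N + 1) (by omega) (by omega)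
      have hE : (e, d) ∈ dashed M b := mem_dashed.2 ⟨he, hd, by simp only; omega,
        by rwa [hd', ← Nat.not_even_iff_odd], by simp only; omega⟩
      refine hA2 (e, d) (mem_union_right _ hE) ⟨Fin.lt_def.2 ?_, Fin.lt_def.2 ?_⟩
      · exact (lt_arc_fst he).2 (by omega)
      · exact (arc_snd_lt hA1 hd).2 hAd

lemma isCorr_of_mem_setSL {A : Fin N × Fin N} (hN1 : N1 M b ≠ 1) (hA : A ∈ outer M b)
    (hA' : A ∈ setSL M b) : IsCorr M b A := by
  obtain ⟨hA1, hA2⟩ := mem_filter.1 hA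
  obtain ⟨-, ⟨s, hs⟩, hAD, hAU⟩ := mem_filter.1 hA'
  obtain ⟨hs1, hs2⟩ := mem_star.1 hs
  have h1 := rank_pos hs1
  have h2 := rank_le b s
  obtain ⟨d, hd, hd'⟩ := exists_rank (b := b) (k := nDown b 0 N) (by omega) le_rfl
  have h3 := (arc_snd_lt hA1 hd).1 (Fin.lt_def.1 (hAD d hd))
  rw [← rank_le_nDown hd A.1.2.le, hd'] at h3
  have hle := nDown_anti (b := b) (Nat.zero_le A.1) A.1.2.le
  rw [N1_eq] at hN1
  exact ⟨fun B hB => hA2 B (mem_union_left _ hB), hAU, by omega, by rw [Nat.even_iff]; omega⟩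

lemma IsCorr.mem {A : Fin N × Fin N} (hM : 1 ≤ M) (hA : A ∈ arcs b) (h : IsCorr M b A) :
    A ∈ outer M b ∧ (A ∈ setSW M b ∨ (N1 M b ≠ 1 ∧ A ∈ setSL M b)) := by
  obtain ⟨h1, h2, h3, h4⟩ := h
  have hle := nDown_anti (b := b) (Nat.zero_le A.1) A.1.2.le
  constructor
  · refine mem_filter.2 ⟨hA, fun B hB hBA => ?_⟩
    rcases mem_union.1 hB with hB | hB
    · exact h1 B hB hBA
    · obtain ⟨e1, e2, e3, e4, e5⟩ := mem_dashed.1 hB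
      have k1 := (lt_arc_fst e1).1 (Fin.lt_def.1 hBA.1)
      have k2 := (rank_le_nDown e2 A.1.2.le).2
        (((arc_snd_lt hA e2).1 (Fin.lt_def.1 hBA.2)))
      rw [Nat.even_iff] at h4
      rw [Nat.odd_iff] at e4
      omega
  · obtain ⟨s, hs, hs'⟩ := exists_rank (b := b) hM (h3.trans hle)
    have hs2 : (A.1 : ℕ) ≤ s := (rank_le_nDown hs A.1.2.le).1 (by omega)
    rcases hle.eq_or_lt with h | h
    · refine Or.inr ⟨?_, mem_filter.2 ⟨hA, ⟨s, mem_star.2 ⟨hs, hs'⟩⟩, fun d hd => ?_, h2⟩⟩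
      · rw [N1_eq, ← h, Nat.even_iff.1 h4]; omega
      · rw [Fin.lt_def, arc_snd_lt hA hd, ← rank_le_nDown hd A.1.2.le, h]
        exact rank_le b d
    · left
      rw [mem_setSW hs hs', arc_snd_lt hA hs]
      refine ⟨hA, hs2, ?_⟩
      obtain ⟨d, hd, hd'⟩ := exists_rank (b := b) (k := nDown b A.1 N + 1) (by omega) h
      have hodd : ¬Even (rank b d - M) := by
        rw [Nat.even_iff] at h4 ⊢; omega
      rcases (unpaired M b).eq_empty_or_nonempty with hU | ⟨u, hu⟩
      · refine Or.inr ⟨hU, ?_⟩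
        have hne : nDown b A.1 N + 1 ≠ nDown b 0 N := fun h' => by
          have hdu : d ∈ unpaired M b := mem_unpaired.2 ⟨hd, by omega, by omega, hodd⟩
          rw [hU] at hdu; simp at hdu
        obtain ⟨e, he, he'⟩ := exists_rank (b := b) (k := nDown b A.1 N + 2) (by omega) (by omega)
        refine ⟨(e, d), mem_dashed.2 ⟨he, hd, by simp only; omega,
          by rwa [← Nat.not_even_iff_odd], by simp only; omega⟩, Fin.lt_def.2 ?_⟩
        exact (lt_arc_fst he).2 (by omega)
      · obtain ⟨u1, u2, u3, u4⟩ := mem_unpaired.1 hu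
        exact Or.inl ⟨u, hu, Fin.lt_def.2 ((lt_arc_fst u1).2 (by omega))⟩

theorem N9_eq (hM : 1 ≤ M) (b : Fin N → Bool) : N9 𝐪 M b = arcProd b (corrWeight M b) 0 N := by
  classical
  have h : arcProd b (corrWeight M b) 0 N = ∏ A ∈ (arcs b).filter (IsCorr M b),
      qInt 𝐪 (d3 A + size A + M) / qInt 𝐪 (d3 A + 2 * size A + M) := by
    rw [arcProd, segProd_eq_prod (fun A _ => ⟨Nat.zero_le _, A.1.2⟩), prod_filter]
    exact prod_congr rfl fun A _ => if_congr Iff.rfl rfl rfl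
  rw [h, N9]
  split_ifs with hN
  · refine prod_congr ?_ fun _ _ => rfl
    ext A
    rw [mem_inter, mem_filter]
    constructor
    · exact fun hA => ⟨(mem_filter.1 hA.1).1, isCorr_of_mem_setSW hA.1 hA.2⟩
    · rintro ⟨hA, hA'⟩
      obtain ⟨h1, h2⟩ := hA'.mem hM hA
      exact ⟨h1, by tauto⟩
  · refine prod_congr ?_ fun _ _ => rfl
    ext A
    rw [mem_inter, mem_filter, mem_union]
    constructor
    · rintro ⟨h1, h2 | h2⟩
      · exact ⟨(mem_filter.1 h1).1, isCorr_of_mem_setSW h1 h2⟩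
      · exact ⟨(mem_filter.1 h1).1, isCorr_of_mem_setSL hN h1 h2⟩
    · rintro ⟨hA, hA'⟩
      obtain ⟨h1, h2⟩ := hA'.mem hM hA
      exact ⟨h1, by tauto⟩

theorem N11_eq (M : ℕ) (b : Fin N → Bool) :
    N11 𝐪 M b = qFact 𝐪 (leftItems M b).card * (∏ u ∈ ups b, qInt 𝐪 (leftNum M b u))⁻¹ := by
  have h : qFact 𝐪 (leftItems M b).card = ∏ a ∈ leftItems M b, qInt 𝐪 (leftNum M b a) :=
    (prod_card_le (leftItems M b) (qInt 𝐪)).symm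
  have hne : ∏ u ∈ ups b, qInt 𝐪 (leftNum M b u) ≠ 0 :=
    prod_ne_zero_iff.2 fun u hu => qInt_ne_zero (card_pos.2 ⟨u, by simp [leftItems, hu]⟩)
  rw [h, leftItems_eq, prod_union (disjoint_ups _ _), prod_union (disjoint_arcs_downs _ _),
    prod_image arcs_fst_inj, filter_or, filter_or, ← setU_eq, ← image_dashed, ← unpaired_eq,
    prod_union, prod_union, prod_image dashed_fst_inj, N11]
  · field_simp
  · rw [image_dashed, unpaired_eq, disjoint_filter]
    tauto
  · rw [image_dashed, unpaired_eq, setU_eq, ← filter_or, disjoint_filter]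
    omega

theorem N12_eq (hM : 1 ≤ M) (b : Fin N → Bool) :
    N12 𝐪 M b = symRise 𝐪 (M - 1) (N2 M b) /
      ((∏ E ∈ dashed M b, qSym 𝐪 (downNum M b E.1)) *
        ∏ C ∈ star M b, qSym 𝐪 (downNum M b C)) := by
  rw [N12]
  congr 1
  · induction N2 M b with
    | zero => simp
    | succ n ih =>
      rw [prod_Icc_succ_top (by omega), ih, symRise_succ]
      congr 2; omega
  · simp only [rightNum_eq]
    rw [setV, union_sdiff_cancel_left (disjoint_setU_star M b)]

lemma downProd_downWeight (M : ℕ) (b : Fin N → Bool) :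
    downProd b (downWeight M b) 0 N = (∏ C ∈ setU M b, (qInt 𝐪 (downNum M b C))⁻¹) *
      (∏ C ∈ star M b, (qInt 𝐪 (2 * downNum M b C))⁻¹) *
      ∏ E ∈ dashed M b, (qInt 𝐪 (2 * downNum M b E.1))⁻¹ := by
  rw [downProd, segProd_eq_prod (fun d _ => ⟨Nat.zero_le _, d.2⟩), setU_eq, star_eq,
    prod_dashed (fun d => (qInt 𝐪 (2 * downNum M b d))⁻¹), prod_filter, prod_filter, prod_filter,
    ← prod_mul_distrib, ← prod_mul_distrib]
  refine prod_congr rfl fun d _ => ?_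
  rw [downWeight]
  rcases lt_trichotomy (rank b d) M with h | h | h
  · rw [if_pos h, if_pos h, if_neg h.ne, if_neg (by omega), mul_one, mul_one]
  · simp [h]
  · simp [h, h.ne', h.not_gt]

theorem psi_eq (hM : 1 ≤ M) (b : Fin N → Bool) :
    psi 𝐪 M b = arcProd b (fun A => (qInt 𝐪 (size A))⁻¹) 0 N * arcProd b (corrWeight M b) 0 N *
      downProd b (downWeight M b) 0 N *
      (qFact 𝐪 (leftItems M b).card * (∏ u ∈ ups b, qInt 𝐪 (leftNum M b u))⁻¹) *
      symRise 𝐪 (M - 1) (N2 M b) * tailWeight M b := by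
  have h1 := prod_N6_N7_N8_N10 hM b
  have h2 : arcProd b (fun A => (qInt 𝐪 (size A))⁻¹) 0 N = ∏ A ∈ arcs b, (qInt 𝐪 (size A))⁻¹ :=
    segProd_eq_prod (fun A _ => ⟨Nat.zero_le _, A.1.2⟩)
  have h3 : psi 𝐪 M b = (∏ A ∈ arcs b, (qInt 𝐪 (size A))⁻¹) *
      (N6 𝐪 M b * N7 𝐪 M b * N8 𝐪 M b * N10 𝐪 M b) * N9 𝐪 M b * N11 𝐪 M b * N12 𝐪 M b := by
    rw [psi]; ring
  rw [h3, h1, h2, N9_eq hM, N11_eq, N12_eq hM, downProd_downWeight]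
  simp only [fun n => qInt_two_mul (q := 𝐪) RatFunc.X_ne_zero n, mul_inv, prod_mul_distrib, prod_inv_distrib]
  rw [div_eq_mul_inv, mul_inv]
  ring

theorem psi_eq_phi (hM : 1 ≤ M) (b : Fin N → Bool) :
    psi 𝐪 M b = blockWeight M (nArc b (cut b) N) (nDown b (cut b) N)
      (nArc b 0 (cut b) + nUp b 0 (cut b)) * hooks b 0 0 (cut b) * phi M b (cut b) := by
  have hk := cut_le b
  have hu : (∏ u ∈ ups b, qInt 𝐪 (leftNum M b u))⁻¹ =
      upProd b (fun u => (qInt 𝐪 (0 + (nArc b 0 (u + 1) + nUp b 0 (u + 1))))⁻¹) 0 (cut b) := by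
    rw [upProd, segProd_eq_prod (fun u hu => ⟨Nat.zero_le _, lt_cut hu⟩), ← prod_inv_distrib]
    exact prod_congr rfl fun u hu => by rw [leftNum_up M hu, zero_add]
  have hcorr : arcProd b (corrWeight M b) 0 (cut b) = 1 := by
    refine prod_eq_one fun A hA => if_neg fun h => ?_
    have h1 := ups_lt_iff.1 h.2.1
    have h2 : (A.1 : ℕ) < cut b := by simpa using (mem_filter.1 hA).2
    omega
  have hdown : downProd b (downWeight M b) 0 (cut b) = 1 :=
    segProd_eq_one fun d hd => by have := cut_le_down hd; omega
  have ha := nArc_add (b := b) (Nat.zero_le _) hk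
  have hup := nUp_add (b := b) (Nat.zero_le _) hk
  rw [nUp_cut] at hup
  have hd := nDown_cut' b
  have key : qFact 𝐪 (leftItems M b).card * symRise 𝐪 (M - 1) (N2 M b) * tailWeight M b =
      blockWeight M (nArc b (cut b) N) (nDown b (cut b) N)
        (nArc b 0 (cut b) + nUp b 0 (cut b)) *
      (qFact 𝐪 (nArc b (cut b) N + downItems M (nDown b (cut b) N)) *
        symRise 𝐪 (M - 1) (nArc b (cut b) N + dashItems M (nDown b (cut b) N))) := by
    have hmin : N2 M b = nUp b 0 (cut b) + (nDown b 0 N - M) % 2 +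
        (nArc b 0 (cut b) + nArc b (cut b) N) + (nDown b 0 N - M) / 2 := by
      rw [N2, card_ups, N1_eq, card_arcs, card_dashed, hup, ha, add_zero]
    have hleft := card_leftItems M b
    rw [hup, ha, add_zero] at hleft
    rw [tailWeight, blockWeight, hd]
    split_ifs with h
    · obtain ⟨c, hc, hc'⟩ := exists_rank (b := b) (k := 1) le_rfl (hM.trans h.1)
      obtain ⟨s, hs, hs'⟩ := exists_rank (b := b) hM h.1
      obtain ⟨d, hd1, hd2⟩ := exists_rank (b := b) (k := nDown b 0 N) (hM.trans h.1) le_rfl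
      have h5 := N5_eq hM hc hc' hs hs' hd1 hd2 h.2
      rw [hd] at h5
      have h6 := Nat.even_iff.1 h.2
      set x := nArc b (cut b) N + downItems M (nDown b 0 N) with hx
      set m := nArc b 0 (cut b) + nUp b 0 (cut b) with hm
      obtain ⟨n, hn⟩ : ∃ n, x + m = n + 1 := ⟨x + m - 1, by simp only [downItems] at hx; omega⟩
      have e1 : (leftItems M b).card = n := by simp only [downItems] at hx; omega
      have e2 : nArc b (cut b) N + dashItems M (nDown b 0 N) + m = N2 M b + 1 := by
        simp only [dashItems]; omega
      have e3 : M - 1 + N2 M b + 1 = n + 1 := by simp only [downItems] at hx; omega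
      have h7 : qFact 𝐪 x * qRise 𝐪 x m = qFact 𝐪 n * qInt 𝐪 (n + 1) := by
        rw [qFact_mul_qRise, hn, qFact_succ]
      have h8 : symRise 𝐪 (M - 1) (nArc b (cut b) N + dashItems M (nDown b 0 N)) *
          symRise 𝐪 (M - 1 + (nArc b (cut b) N + dashItems M (nDown b 0 N))) m =
          symRise 𝐪 (M - 1) (N2 M b) * qSym 𝐪 (n + 1) := by
        rw [← symRise_add, e2, symRise_succ, e3]
      have h9 : qInt 𝐪 (2 * x + 2 * m) = qInt 𝐪 (n + 1) * qSym 𝐪 (n + 1) := by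
        rw [← mul_add, hn, qInt_two_mul RatFunc.X_ne_zero]
      have z1 := qInt_ne_zero (Nat.succ_pos n)
      have z2 := qSym_ne_zero (Nat.succ_pos n)
      rw [e1, h5, h9]
      calc _ = (qFact 𝐪 n * qInt 𝐪 (n + 1)) * (symRise 𝐪 (M - 1) (N2 M b) * qSym 𝐪 (n + 1)) *
            (qInt 𝐪 (2 * x + m) / (qInt 𝐪 (n + 1) * qSym 𝐪 (n + 1))) := by
            simp only [Nat.succ_eq_add_one] at z1 z2
            field_simp
        _ = _ := by rw [← h7, ← h8]; ring
    · rw [Nat.even_iff] at h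
      have e1 : (leftItems M b).card = nArc b (cut b) N + downItems M (nDown b 0 N) +
          (nArc b 0 (cut b) + nUp b 0 (cut b)) := by
        simp only [downItems]; omega
      have e2 : N2 M b = nArc b (cut b) N + dashItems M (nDown b 0 N) +
          (nArc b 0 (cut b) + nUp b 0 (cut b)) := by
        simp only [dashItems]; omega
      rw [e1, e2, ← qFact_mul_qRise, symRise_add _ _ (nArc b 0 (cut b) + nUp b 0 (cut b))]
      ring
  rw [psi_eq hM, hu, arcProd_mul (Nat.zero_le _) hk, arcProd_mul (Nat.zero_le _) hk, hcorr,
    downProd_mul (Nat.zero_le _) hk, hdown, hooks, phi]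
  linear_combination (arcProd b (fun A => (qInt 𝐪 (size A))⁻¹) 0 (cut b) *
    arcProd b (fun A => (qInt 𝐪 (size A))⁻¹) (cut b) N * arcProd b (corrWeight M b) (cut b) N *
    downProd b (downWeight M b) (cut b) N *
    upProd b (fun u => (qInt 𝐪 (0 + (nArc b 0 (u + 1) + nUp b 0 (u + 1))))⁻¹) 0 (cut b)) * key

lemma bar_psi (M : ℕ) (b : Fin N → Bool) : bar (psi 𝐪 M b) = psi 𝐪 M b := by
  simp only [psi, N6, N7, N8, N9, N10, N11, N12, map_mul, map_prod, map_inv₀, map_div₀,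
    apply_ite bar, map_one, bar_qInt, bar_qSym]

lemma degD_eq (hM : 1 ≤ M) (b : Fin N → Bool) :
    (degD M b : ℤ) = plusSum b (fun l => (N : ℤ) + M - 1 - (l : ℕ)) 0 N := by
  rw [degD, plusSum, segSum_eq_sum fun d _ => ⟨Nat.zero_le _, d.2⟩, Nat.cast_sum]
  refine sum_congr rfl fun l _ => ?_
  have := l.2
  omega

theorem good_psi (hM : 1 ≤ M) (b : Fin N → Bool) : Good (psi 𝐪 M b) (degD M b) := by
  rw [psi_eq_phi hM, degD_eq hM, plusSum_add (Nat.zero_le _) (cut_le b)]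
  exact (good_block hM (closed_cut' b) (closed_cut b) (nUp_cut b) (nDown_cut b)).mul
    (good_phi hM (closed_cut b) (nUp_cut b))

end Assemble

end TypeBI

/-- For type BI with `Q = q^M`, every component `Ψ_D` lies in `ℕ[q, q⁻¹]`, is invariant under
`q ↦ q⁻¹`, and has leading term `q^{d_D}` with coefficient one. -/
theorem mainTheorem10 (M : ℕ) (hM : 1 ≤ M) (N : ℕ) (b : Fin N → Bool) :
    ∃ P : LaurentPolynomial ℕ,
      TypeBI.psi (RatFunc.X : RatFunc ℂ) M b = TypeBI.ofLaurent P ∧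
      LaurentPolynomial.invert P = P ∧
      P.coeff (TypeBI.degD M b : ℤ) = 1 ∧
      ∀ n : ℤ, (TypeBI.degD M b : ℤ) < n → P.coeff n = 0 :=
  (TypeBI.good_psi hM b).exists_laurent (TypeBI.bar_psi M b)
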